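/- Let $\mathbf F_q$ be a finite field with $q\ge 5$ elements. Let $P$ be a closed point of degree $3$ of $\mathbf P^2$ over $\mathbf F_q$ which does not lie on any $\mathbf F_q$-rational line (such points exist). Let $\pi\colon Z\to\mathbf P^2$ be the blow-up of $\mathbf P^2$ at $P$, let $E$ be its exceptional divisor, and let $\mathcal L_5=\pi^*\mathcal O_{\mathbf P^2}(5)\otimes\mathcal O_Z(-E)$ be the line bundle on $Z$ associated to $\pi^*\Gamma_5-E$, where $\Gamma_5$ is the linear system of plane quintics containing $P$. Let $P_1,\dots,P_n$ be the rational points of $Z$, and let $C_L(Z,\mathcal L_5)\subset\mathbf F_q^n$ be the image of the evaluation map $H^0(Z,\mathcal L_5)\to\bigoplus_{i}(\mathcal L_5)_{P_i}\simeq\mathbf F_q^n$, where the fibres $(\mathcal L_5)_{P_i}$ are identified with $\mathbf F_q$ in an arbitrary way. Then $C_L(Z,\mathcal L_5)$ is a $[q^2+q+1,\ 18,\ q^2-3q-1]$ code: its length is $n=q^2+q+1$, its dimension is $18$, and its minimum distance is exactly $q^2-3q-1$. In particular, for $q=9$ it is a $[91,18,53]$ code over $\mathbf F_9$. -/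

import Mathlib

open MvPolynomial

noncomputable section

namespace BlowupCode

attribute [local instance] MvPolynomial.gradedAlgebra

variable (k : Type*) [Field k]

/-- The (scheme-theoretic) points of the projective plane `ℙ²` over `k`: the relevant homogeneous
prime ideals of `k[X₀, X₁, X₂]`. -/
abbrev PlanePoint : Type _ := ProjectiveSpectrum (homogeneousSubmodule (Fin 3) k)

/-- The field `k(X₀, X₁, X₂)`. Its elements of degree `0` form the function field of `ℙ²`, and its
elements of degree `m` are the rational sections of `𝒪(m)`. Local rings and stalks of line bundles
are realised as subsets of this field. -/
abbrev Amb : Type _ := FractionRing (MvPolynomial (Fin 3) k)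

variable {k}

/-- The stalk at `x` of the twisting sheaf `𝒪(m)` on `ℙ²`: fractions `a / b` of forms with
`deg a = deg b + m` and `b` not vanishing at `x`. -/
def twistStalk (m : ℕ) (x : PlanePoint k) : Submodule k (Amb k) where
  carrier := {f | ∃ n : ℕ, ∃ a ∈ homogeneousSubmodule (Fin 3) k (n + m),
    ∃ b ∈ homogeneousSubmodule (Fin 3) k n, b ∉ x.asHomogeneousIdeal ∧
      f = algebraMap _ (Amb k) a / algebraMap _ (Amb k) b}
  zero_mem' := ⟨0, 0, Submodule.zero_mem _, 1, isHomogeneous_one _ _,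
    fun h => x.isPrime.ne_top ((Ideal.eq_top_iff_one _).2 h), by simp⟩
  add_mem' := by
    rintro _ _ ⟨n, a, ha, b, hb, hbx, rfl⟩ ⟨n', a', ha', b', hb', hbx', rfl⟩
    have hb0 : algebraMap _ (Amb k) b ≠ 0 := by
      intro h
      rw [map_eq_zero_iff _ (IsFractionRing.injective _ _)] at h
      exact hbx (h ▸ zero_mem _)
    have hb0' : algebraMap _ (Amb k) b' ≠ 0 := by
      intro h
      rw [map_eq_zero_iff _ (IsFractionRing.injective _ _)] at h
      exact hbx' (h ▸ zero_mem _)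
    refine ⟨n + n', a * b' + b * a', ?_, b * b', hb.mul hb',
      fun h => (x.isPrime.mem_or_mem h).elim hbx hbx', ?_⟩
    · refine IsHomogeneous.add ?_ ?_
      · have := IsHomogeneous.mul ha hb'
        rwa [show n + m + n' = n + n' + m by ring] at this
      · have := IsHomogeneous.mul hb ha'
        rwa [show n + (n' + m) = n + n' + m by ring] at this
    · rw [div_add_div _ _ hb0 hb0']
      simp
  smul_mem' := by
    rintro c _ ⟨n, a, ha, b, hb, hbx, rfl⟩
    refine ⟨n, c • a, Submodule.smul_mem _ _ ha, b, hb, hbx, ?_⟩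
    rw [Algebra.smul_def c a, map_mul, ← IsScalarTower.algebraMap_apply, mul_div_assoc,
      ← Algebra.smul_def]

/-- The local ring `𝒪_{ℙ², x}`. -/
def localRing (x : PlanePoint k) : Subalgebra k (Amb k) :=
  (twistStalk 0 x).toSubalgebra
    ⟨0, 1, isHomogeneous_one _ _, 1, isHomogeneous_one _ _,
      fun h => x.isPrime.ne_top ((Ideal.eq_top_iff_one _).2 h), by simp⟩
    (by
      rintro _ _ ⟨n, a, ha, b, hb, hbx, rfl⟩ ⟨n', a', ha', b', hb', hbx', rfl⟩
      rw [add_zero] at ha ha'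
      refine ⟨n + n', a * a', IsHomogeneous.mul (m := n) (n := n') ha ha', b * b', hb.mul hb',
        fun h => (x.isPrime.mem_or_mem h).elim hbx hbx', ?_⟩
      rw [div_mul_div_comm, map_mul, map_mul])

theorem mem_localRing {x : PlanePoint k} {f : Amb k} : f ∈ localRing x ↔ ∃ n : ℕ,
    ∃ a ∈ homogeneousSubmodule (Fin 3) k n, ∃ b ∈ homogeneousSubmodule (Fin 3) k n,
      b ∉ x.asHomogeneousIdeal ∧ f = algebraMap _ (Amb k) a / algebraMap _ (Amb k) b :=
  Iff.rfl

theorem isLocalRing_of_inv (B : Subalgebra k (Amb k))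
    (h : ∀ f ∈ B, f⁻¹ ∈ B ∧ f ≠ 0 ∨ (1 - f)⁻¹ ∈ B ∧ 1 - f ≠ 0) : IsLocalRing B := by
  refine IsLocalRing.of_isUnit_or_isUnit_one_sub_self fun f => ?_
  rcases h f f.2 with h | h
  · exact Or.inl (IsUnit.of_mul_eq_one ⟨_, h.1⟩ (Subtype.ext (mul_inv_cancel₀ h.2)))
  · exact Or.inr (IsUnit.of_mul_eq_one ⟨_, h.1⟩ (Subtype.ext (mul_inv_cancel₀ h.2)))

instance (x : PlanePoint k) : IsLocalRing (localRing x) := by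
  refine isLocalRing_of_inv _ ?_
  intro f hf
  obtain ⟨n, a, ha, b, hb, hbx, rfl⟩ := mem_localRing.1 hf
  have key : ∀ c : MvPolynomial (Fin 3) k, c ∉ x.asHomogeneousIdeal →
      algebraMap _ (Amb k) c ≠ 0 := by
    intro c hc h
    rw [map_eq_zero_iff _ (IsFractionRing.injective _ _)] at h
    exact hc (h ▸ zero_mem _)
  by_cases hax : a ∈ x.asHomogeneousIdeal
  · right
    have hba : b - a ∉ x.asHomogeneousIdeal := fun h => hbx (by
      have := add_mem h hax
      rwa [sub_add_cancel] at this)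
    have e : 1 - algebraMap _ (Amb k) a / algebraMap _ (Amb k) b
        = algebraMap _ (Amb k) (b - a) / algebraMap _ (Amb k) b := by
      rw [map_sub, sub_div, div_self (key b hbx)]
    rw [e, inv_div]
    exact ⟨⟨n, b, hb, b - a, Submodule.sub_mem _ hb ha, hba, rfl⟩,
      div_ne_zero (key _ hba) (key b hbx)⟩
  · left
    rw [inv_div]
    exact ⟨⟨n, b, hb, a, ha, hax, rfl⟩, div_ne_zero (key a hax) (key b hbx)⟩

/-- The stalk at `x` of the ideal sheaf of (the closure of) the point `P`: fractions `a / b` of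
forms of the same degree, where `a` vanishes at `P` and `b` does not vanish at `x`. -/
def idealStalk (P x : PlanePoint k) : Submodule k (Amb k) :=
  Submodule.span k {f | ∃ n : ℕ, ∃ a ∈ homogeneousSubmodule (Fin 3) k n,
    ∃ b ∈ homogeneousSubmodule (Fin 3) k n, a ∈ P.asHomogeneousIdeal ∧
      b ∉ x.asHomogeneousIdeal ∧ f = algebraMap _ (Amb k) a / algebraMap _ (Amb k) b}

/-- `P` is a closed point of degree `d` of `ℙ²`. -/
def IsClosedPointOfDegree (P : PlanePoint k) (d : ℕ) : Prop :=
  IsClosed ({P} : Set (PlanePoint k)) ∧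
    Module.finrank k (IsLocalRing.ResidueField (localRing P)) = d

/-- The point `P` lies on the line with equation `l = 0` for some nonzero linear form `l` with
coefficients in `k`. -/
def LiesOnRationalLine (P : PlanePoint k) : Prop :=
  ∃ l ∈ homogeneousSubmodule (Fin 3) k 1, l ≠ 0 ∧ l ∈ P.asHomogeneousIdeal

/-- The localization of a subring `B` of a field at a prime ideal `𝔮` of `B`, as a subring of the
field. -/
def locAt (B : Subalgebra k (Amb k)) (𝔮 : Ideal B) [𝔮.IsPrime] : Subalgebra k (Amb k) where
  carrier := {f | ∃ b c : B, c ∉ 𝔮 ∧ f = (b : Amb k) / (c : Amb k)}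
  mul_mem' := by
    rintro _ _ ⟨b, c, hc, rfl⟩ ⟨b', c', hc', rfl⟩
    refine ⟨b * b', c * c', fun h => (Ideal.IsPrime.mem_or_mem ‹_› h).elim hc hc', ?_⟩
    rw [div_mul_div_comm]
    rfl
  add_mem' := by
    rintro _ _ ⟨b, c, hc, rfl⟩ ⟨b', c', hc', rfl⟩
    have h0 : (c : Amb k) ≠ 0 := fun h => hc (by
      rw [show c = 0 from Subtype.ext h]; exact zero_mem _)
    have h0' : (c' : Amb k) ≠ 0 := fun h => hc' (by
      rw [show c' = 0 from Subtype.ext h]; exact zero_mem _)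
    refine ⟨b * c' + c * b', c * c', fun h => (Ideal.IsPrime.mem_or_mem ‹_› h).elim hc hc', ?_⟩
    rw [div_add_div _ _ h0 h0']
    rfl
  algebraMap_mem' := fun r => ⟨algebraMap k B r, 1,
    fun h => Ideal.IsPrime.ne_top ‹_› ((Ideal.eq_top_iff_one _).2 h), by
      rw [OneMemClass.coe_one, div_one]
      rfl⟩

theorem isLocalRing_locAt (B : Subalgebra k (Amb k)) (𝔮 : Ideal B) [𝔮.IsPrime] :
    IsLocalRing (locAt B 𝔮) := by
  refine isLocalRing_of_inv _ ?_
  rintro _ ⟨b, c, hc, rfl⟩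
  have key : ∀ c : B, c ∉ 𝔮 → (c : Amb k) ≠ 0 := fun c hc h => hc (by
    rw [show c = 0 from Subtype.ext h]; exact zero_mem _)
  by_cases hb : b ∈ 𝔮
  · right
    have hcb : c - b ∉ 𝔮 := fun h => hc (by
      have := add_mem h hb
      rwa [sub_add_cancel] at this)
    have e : 1 - (b : Amb k) / (c : Amb k) = ((c - b : B) : Amb k) / (c : Amb k) := by
      rw [AddSubgroupClass.coe_sub, sub_div, div_self (key c hc)]
    rw [e, inv_div]
    exact ⟨⟨c, c - b, hcb, rfl⟩, div_ne_zero (key _ hcb) (key c hc)⟩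
  · left
    rw [inv_div]
    exact ⟨⟨c, b, hb, rfl⟩, div_ne_zero (key b hb) (key c hc)⟩

/-- For `a` in the ideal `I_x` of `P` in `𝒪_{ℙ², x}`, the coordinate ring `𝒪_{ℙ², x}[I_x / a]` of
the chart of the blow-up of `I_x` on which `a` generates the inverse image ideal. -/
def chart (P x : PlanePoint k) (a : Amb k) : Subalgebra k (Amb k) :=
  Algebra.adjoin k ((localRing x : Set (Amb k)) ∪ {f | ∃ g ∈ idealStalk P x, f = g / a})

/-- The points of the blow-up `π : Z → ℙ²` of the projective plane at the closed point `P`. As `Z`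
is integral and separated, a point `z` is given by its image `base = π(z)` and by its local ring
`ring = 𝒪_{Z, z}` inside the function field: a localization at a prime ideal of a chart of the
blow-up which dominates `𝒪_{ℙ², π(z)}` (an element of the latter that becomes a unit in `𝒪_{Z, z}`
is a unit). All points of the scheme `Z` are listed, closed or not. -/
@[ext]
structure BlowupPoint (P : PlanePoint k) where
  base : PlanePoint k
  ring : Subalgebra k (Amb k)
  exists_chart : ∃ a ∈ idealStalk P base, a ≠ 0 ∧
    ∃ (𝔮 : Ideal (chart P base a)) (_ : 𝔮.IsPrime), ring = locAt (chart P base a) 𝔮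
  dominates : ∀ f ∈ localRing base, f⁻¹ ∈ ring → f⁻¹ ∈ localRing base

namespace BlowupPoint

variable {P : PlanePoint k}

instance (z : BlowupPoint P) : IsLocalRing z.ring := by
  obtain ⟨a, -, -, 𝔮, h𝔮, h⟩ := z.exists_chart
  rw [h]
  exact isLocalRing_locAt _ _

/-- The maximal ideal of `𝒪_{Z, z}`, as a subspace of the ambient field. -/
def maxIdeal (z : BlowupPoint P) : Submodule k (Amb k) :=
  ((IsLocalRing.maximalIdeal z.ring).restrictScalars k).map z.ring.val.toLinearMap

/-- `z` is a rational point of `Z`: its residue field is `k`. -/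
def IsRational (z : BlowupPoint P) : Prop :=
  Module.finrank k (IsLocalRing.ResidueField z.ring) = 1

/-- The stalk at `z` of the line bundle `ℒ_m = π^*𝒪(m) ⊗ 𝒪_Z(-E)` on `Z`, where `E` is the
exceptional divisor, so that `𝒪_Z(-E)` is the inverse image ideal sheaf of the ideal sheaf of `P`.
The products are products of `k`-subspaces (spans of products of elements). -/
def lineStalk (m : ℕ) (z : BlowupPoint P) : Submodule k (Amb k) :=
  twistStalk m z.base * idealStalk P z.base * Subalgebra.toSubmodule z.ring

/-- The fibre of `ℒ_m` at `z`, that is, the stalk modulo the maximal ideal times the stalk. -/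
abbrev Fibre (m : ℕ) (z : BlowupPoint P) : Type _ :=
  lineStalk m z ⧸ (maxIdeal z * lineStalk m z).submoduleOf (lineStalk m z)

end BlowupPoint

open BlowupPoint

/-- The space of global sections `H⁰(Z, ℒ_m)`: as `ℒ_m` is a subsheaf of a constant sheaf, these
are the elements which lie in the stalk at every point of `Z`. -/
def globalSections (P : PlanePoint k) (m : ℕ) : Submodule k (Amb k) :=
  ⨅ z : BlowupPoint P, lineStalk m z

/-- The choices on which the code as a subspace of `kⁿ` depends: an enumeration `P₁, …, Pₙ` of the
rational points of `Z`, and coordinates on the fibres of `ℒ_m` at these points. -/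
structure Frame (P : PlanePoint k) (m n : ℕ) where
  pts : Fin n ≃ {z : BlowupPoint P // z.IsRational}
  coord : ∀ i, Fibre m (pts i).1 ≃ₗ[k] k

/-- The evaluation map `H⁰(Z, ℒ_m) → kⁿ`. -/
def evalMap {P : PlanePoint k} {m n : ℕ} (φ : Frame P m n) :
    globalSections P m →ₗ[k] (Fin n → k) :=
  LinearMap.pi fun i => (φ.coord i).toLinearMap ∘ₗ Submodule.mkQ _ ∘ₗ
    Submodule.inclusion (iInf_le (fun z : BlowupPoint P => lineStalk m z) (φ.pts i).1)

/-- The code `C_L(Z, ℒ_m)`. -/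
def code {P : PlanePoint k} {m n : ℕ} (φ : Frame P m n) : Submodule k (Fin n → k) :=
  LinearMap.range (evalMap φ)

/-- A linear code `C` in `kⁿ` has parameters `[n, κ, d]`: its dimension is `κ` and its minimum
distance is (exactly) `d`. -/
def IsCodeWithParameters [DecidableEq k] (n κ d : ℕ) (C : Submodule k (Fin n → k)) : Prop :=
  Module.finrank k C = κ ∧
    IsLeast {t | ∃ u ∈ C, ∃ v ∈ C, u ≠ v ∧ t = hammingDist u v} d

/-- The code `C_L(Z, ℒ_m)` on the blow-up `Z` of `ℙ²` at `P` has parameters `[n, κ, d]`: the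
surface `Z` has exactly `n` rational points, the fibres of `ℒ_m` at them are lines, and for any
choice of an order of the points and of coordinates on the fibres the code has dimension `κ` and
minimum distance `d`. -/
def BlowupCodeHasParameters [DecidableEq k] (P : PlanePoint k) (m n κ d : ℕ) : Prop :=
  Nonempty (Frame P m n) ∧ ∀ φ : Frame P m n, IsCodeWithParameters n κ d (code φ)

end BlowupCode

end

/-! ### Double counting in finite projective planes. -/

section PlaneCounting

open Configuration Configuration.ProjectivePlane Finset
open scoped Classical

set_option linter.unusedSectionVars false

/-! A section of `ℒ₅` over `Z` is a quintic form through `P`: outside the closed point `P` it is a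
section of `𝒪(5)` with no pole along any curve, hence a form, and the twist by `-E` says that the
form vanishes at `P` (`globalSections_eq`). Since `P` has degree `3` and lies on no rational line,
the values of linear forms fill its residue field, so `P` imposes three independent conditions and
the space has dimension `21 - 3 = 18` (`finrank_formsThrough`). No rational point of `Z` lies over
`P`, so these points are the `q² + q + 1` rational points of the plane (`exists_equiv_rational`),
and the weight of a codeword is the number of rational points where the quintic is nonzero.

It remains to see that a nonzero quintic through `P` has at most `4q + 2` rational zeros and that
this is attained. After splitting off rational lines, the residual curve of degree `e ≥ 2` still
passes through `P` and contains no rational line (`exists_containsNoLine_factor`). A count with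
tangent lines (`TangentSystem.two_mul_card_le`) gives such a curve at most `(e - 1)q + e/2` points;
together with the lines this is `4q + 2` except for `e = 4`, where one point must be saved. A
quartic with `3q + 2` points would have a rigid system of bitangents, forcing characteristic `2` and
then `q = 4` (`card_zeros_quartic_le`). Equality in the quintic bound holds for a conic through `P`
with `q + 1` points together with three concurrent lines missing its rational points
(`exists_quintic_card_zeros`). -/

theorem sum_card_filter_of_pairwise {α β : Type*} [Fintype α] [Fintype β] (R : α → β → Prop)
    (q : ℕ) (h1 : ∀ a, #{b | R a b} = q + 1)
    (h2 : ∀ a a', a ≠ a' → #{b | R a b ∧ R a' b} = 1) (K : Finset α) (a : α) :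
    ∑ b with R a b, #{x ∈ K | R x b} = #K + if a ∈ K then q else 0 := by
  simp only [card_filter, sum_filter]
  have : ∀ b, (if R a b then ∑ x ∈ K, if R x b then 1 else 0 else 0) =
      ∑ x ∈ K, if R a b ∧ R x b then 1 else 0 := by
    intro b; split_ifs with h <;> simp [h]
  simp only [this]
  rw [sum_comm]
  have h3 : ∀ x, (∑ b, if R a b ∧ R x b then 1 else 0) = 1 + if a = x then q else 0 := by
    intro x
    rw [← card_filter]
    split_ifs with h
    · subst h; simp [h1, add_comm]
    · exact h2 a x h
  simp only [h3, sum_add_distrib]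
  simp

variable {P L : Type*} [Membership P L] [ProjectivePlane P L] [Fintype P] [Fintype L]

theorem card_lines_through (p : P) : #{l : L | p ∈ l} = order P L + 1 := by
  rw [← lineCount_eq L p, lineCount, Nat.card_eq_fintype_card, Fintype.card_subtype]

theorem card_points_on (l : L) : #{p : P | p ∈ l} = order P L + 1 := by
  rw [← pointCount_eq P l, pointCount, Nat.card_eq_fintype_card, Fintype.card_subtype]

theorem card_lines_through_two {p p' : P} (h : p ≠ p') : #{l : L | p ∈ l ∧ p' ∈ l} = 1 := by
  obtain ⟨l, hl, hu⟩ := HasLines.existsUnique_line P L p p' h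
  exact card_eq_one.2 ⟨l, by ext m; simpa using ⟨hu m, fun e => e ▸ hl⟩⟩

theorem card_points_on_two {l l' : L} (h : l ≠ l') : #{p : P | p ∈ l ∧ p ∈ l'} = 1 := by
  obtain ⟨p, hp, hu⟩ := HasPoints.existsUnique_point P L l l' h
  exact card_eq_one.2 ⟨p, by ext m; simpa using ⟨hu m, fun e => e ▸ hp⟩⟩

theorem sum_card_filter_lines (K : Finset P) (p : P) :
    ∑ l : L with p ∈ l, #{x ∈ K | x ∈ l} = #K + if p ∈ K then order P L else 0 :=
  sum_card_filter_of_pairwise (fun (p : P) (l : L) => p ∈ l) _ card_lines_through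
    (fun _ _ => card_lines_through_two) K p

theorem sum_card_filter_points (B : Finset L) (l : L) :
    ∑ p : P with p ∈ l, #{m ∈ B | p ∈ m} = #B + if l ∈ B then order P L else 0 :=
  sum_card_filter_of_pairwise (fun (l : L) (p : P) => p ∈ l) _ card_points_on
    (fun _ _ => card_points_on_two) B l

theorem sum_sum_comm_incidence (K : Finset P) (g : L → ℤ) :
    ∑ p ∈ K, ∑ l : L with p ∈ l, g l = ∑ l : L, (#{x ∈ K | x ∈ l} : ℤ) * g l := by
  simp only [sum_filter]
  rw [sum_comm]
  refine sum_congr rfl fun l _ => ?_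
  rw [← sum_filter, sum_const, nsmul_eq_mul]

/-- Every other point of `K` lies on one line through `p`, and `p` lies on all of them. So the total
deficit of the pencil, called `D` below, is the same at every point of `K`. -/
theorem sum_deficit (K : Finset P) (d : ℤ) {p : P} (hp : p ∈ K) :
    ∑ l : L with p ∈ l, (d - #{x ∈ K | x ∈ l}) = (d - 1) * order P L + d - #K := by
  have h := sum_card_filter_lines (L := L) K p
  rw [if_pos hp] at h
  have h' : ∑ l : L with p ∈ l, (#{x ∈ K | x ∈ l} : ℤ) = #K + order P L := by exact_mod_cast h
  rw [sum_sub_distrib, h', sum_const, card_lines_through, nsmul_eq_mul]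
  push_cast
  ring

/-- The incidence data of a set `K` of points with a relation of tangency, such that each line
counts at most `d` points of `K` when points of tangency are counted twice. -/
structure TangentSystem (K : Finset P) (T : P → L → Prop) (d : ℕ) : Prop where
  mem : ∀ p l, T p l → p ∈ K ∧ p ∈ l
  exists_tangent : ∀ p ∈ K, ∃ l, T p l
  card_add_card_le : ∀ l, #{x ∈ K | x ∈ l} + #{x | T x l} ≤ d

namespace TangentSystem

variable {K : Finset P} {T : P → L → Prop} {d : ℕ}

theorem card_le (h : TangentSystem K T d) (l : L) :
    (#{x | T x l} : ℤ) ≤ d - #{x ∈ K | x ∈ l} := by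
  have := h.card_add_card_le l
  zify at this
  linarith

theorem sum_card_tangent_le (h : TangentSystem K T d) {p : P} (hp : p ∈ K) :
    ∑ l : L with p ∈ l, (#{x | T x l} : ℤ) ≤ (d - 1) * order P L + d - #K :=
  (sum_le_sum fun l _ => h.card_le l).trans_eq (sum_deficit K d hp)

theorem sum_mul_le (h : TangentSystem K T d) :
    ∑ l : L, (#{x ∈ K | x ∈ l} : ℤ) * #{x | T x l} ≤ ((d - 1) * order P L + d - #K) * #K := by
  rw [← sum_sum_comm_incidence]
  refine (sum_le_sum fun p hp => h.sum_card_tangent_le hp).trans_eq ?_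
  rw [sum_const, nsmul_eq_mul, mul_comm]

theorem card_le_sum (h : TangentSystem K T d) : (#K : ℤ) ≤ ∑ l : L, (#{x | T x l} : ℤ) := by
  have : #K ≤ ∑ l : L, #{x | T x l} := by
    simp only [card_filter]
    rw [sum_comm, card_eq_sum_ones, ← sum_subset (subset_univ K)]
    · refine sum_le_sum fun p hp => ?_
      obtain ⟨l, hl⟩ := h.exists_tangent p hp
      rw [← card_filter]
      exact card_pos.2 ⟨l, by simpa using hl⟩
    · intro p _ hp
      exact sum_eq_zero fun l _ => if_neg fun hl => hp (h.mem _ _ hl).1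
  exact_mod_cast this

/-- All deficits are nonnegative, so the deficit of the single line `l` is at most the total `D` of
the pencil at `p`: tangent lines carry many points of `K`. -/
theorem le_card_of_tangent (h : TangentSystem K T d) {p : P} {l : L} (hl : T p l) :
    (d : ℤ) - ((d - 1) * order P L + d - #K) ≤ #{x ∈ K | x ∈ l} := by
  have hp := h.mem _ _ hl
  have := single_le_sum (s := {l : L | p ∈ l}) (f := fun l => (d : ℤ) - #{x ∈ K | x ∈ l})
    (fun m _ => (Int.natCast_nonneg _).trans (h.card_le m)) (a := l) (by simpa using hp.2)
  rw [sum_deficit K d hp.1] at this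
  linarith

/-- Count the points of `K` on each line, weighted by the number of tangencies of the line. Summing
over pencils bounds the total by `D * #K`; as tangent lines carry at least `d - D` points and every
point has a tangent, the total is at least `(d - D) * #K`. Hence `d ≤ 2 * D` when `K` is nonempty.
-/
theorem two_mul_card_le (h : TangentSystem K T d) (hd : 0 < d) :
    2 * #K ≤ 2 * (d - 1) * order P L + d := by
  obtain ⟨e, rfl⟩ : ∃ e, d = e + 1 := ⟨d - 1, by omega⟩
  by_contra! hlt
  have hK : (0 : ℤ) < #K := by
    have : 0 < #K := by
      rcases Nat.eq_zero_or_pos (#K) with h0 | h0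
      · omega
      · exact h0
    exact_mod_cast this
  set D : ℤ := ((e + 1 : ℕ) - 1) * order P L + (e + 1 : ℕ) - #K with hD
  have hDd : 2 * D < (e + 1 : ℕ) := by
    zify at hlt
    simp at hlt
    rw [hD]; push_cast; nlinarith
  have h1 := h.sum_mul_le
  have h2 := h.card_le_sum
  have hpos : (0 : ℤ) ≤ (e + 1 : ℕ) - D := by
    have : (0 : ℤ) ≤ (e + 1 : ℕ) := by positivity
    by_contra hc
    linarith
  have h3 : ∑ l : L, ((e + 1 : ℕ) - D) * (#{x | T x l} : ℤ) ≤
      ∑ l : L, (#{x ∈ K | x ∈ l} : ℤ) * #{x | T x l} := by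
    refine sum_le_sum fun l _ => ?_
    rcases Finset.eq_empty_or_nonempty ({x | T x l} : Finset P) with h0 | ⟨p, hp⟩
    · simp [h0]
    · exact mul_le_mul_of_nonneg_right (h.le_card_of_tangent (by simpa using hp)) (by positivity)
  rw [← mul_sum] at h3
  nlinarith [mul_le_mul_of_nonneg_left h2 hpos]

/-- In the extremal case of a tangent system of degree `4`, the lines through points of `K` are
bitangents and lines with four points. -/
theorem extremal_four (h : TangentSystem K T 4) (hK : #K = 3 * order P L + 2) :
    (∀ l, 0 < #{x | T x l} → #{x ∈ K | x ∈ l} = 2 ∧ #{x | T x l} = 2) ∧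
    (∀ l, #{x | T x l} = 0 → #{x ∈ K | x ∈ l} = 0 ∨ #{x ∈ K | x ∈ l} = 4) ∧
    (∀ p ∈ K, #{l : L | p ∈ l ∧ 0 < #{x | T x l}} = 1) ∧
    2 * #{l : L | 0 < #{x | T x l}} = #K := by
  -- Here `D = 2 = d - D`, so the two bounds of the weighted count coincide and each termwise
  -- inequality used in it is an equality.
  have hD : (((4 : ℕ) : ℤ) - 1) * order P L + (4 : ℕ) - #K = 2 := by
    rw [hK]; push_cast; ring
  have h1 := h.sum_mul_le
  have h2 := h.card_le_sum
  rw [hD] at h1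
  have h3 : ∀ l ∈ (univ : Finset L), 2 * (#{x | T x l} : ℤ) ≤
      (#{x ∈ K | x ∈ l} : ℤ) * #{x | T x l} := by
    intro l _
    rcases Finset.eq_empty_or_nonempty ({x | T x l} : Finset P) with h0 | ⟨p, hp⟩
    · simp [h0]
    · have := h.le_card_of_tangent (l := l) (p := p) (by simpa using hp)
      rw [hD] at this
      exact mul_le_mul_of_nonneg_right (by push_cast at this; linarith) (by positivity)
  have h3' := sum_le_sum h3
  rw [← mul_sum] at h3'
  have h4 : ∀ l ∈ (univ : Finset L), 2 * (#{x | T x l} : ℤ) =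
      (#{x ∈ K | x ∈ l} : ℤ) * #{x | T x l} := by
    refine (sum_eq_sum_iff_of_le h3).1 ?_
    rw [← mul_sum]
    linarith
  have hS : ∑ l : L, (#{x | T x l} : ℤ) = #K := by linarith
  have h5 : ∀ p ∈ K, ∑ l : L with p ∈ l, (#{x | T x l} : ℤ) = 2 := by
    have hle : ∀ p ∈ K, ∑ l : L with p ∈ l, (#{x | T x l} : ℤ) ≤ 2 := fun p hp =>
      (h.sum_card_tangent_le hp).trans_eq hD
    refine (sum_eq_sum_iff_of_le hle).1 ?_
    rw [sum_sum_comm_incidence, ← sum_congr rfl h4, ← mul_sum, hS, sum_const, nsmul_eq_mul,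
      mul_comm]
  have h6 : ∀ p ∈ K, ∀ l : L, p ∈ l →
      (#{x | T x l} : ℤ) = (4 : ℕ) - #{x ∈ K | x ∈ l} := by
    intro p hp l hl
    refine (sum_eq_sum_iff_of_le (s := {l : L | p ∈ l}) fun l _ => h.card_le l).1 ?_ l
      (by simpa using hl)
    rw [h5 p hp, sum_deficit K _ hp, hD]
  have hA : ∀ l, 0 < #{x | T x l} → #{x ∈ K | x ∈ l} = 2 ∧ #{x | T x l} = 2 := by
    intro l hl
    have a := h4 l (mem_univ _)
    obtain ⟨p, hp⟩ := card_pos.1 hl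
    have hp' := h.mem p l (by simpa using hp)
    have b := h6 p hp'.1 l hp'.2
    have c : (#{x ∈ K | x ∈ l} : ℤ) = 2 := by
      have : (0 : ℤ) < #{x | T x l} := by exact_mod_cast hl
      exact (mul_right_cancel₀ this.ne' a).symm
    rw [c] at b
    exact ⟨by exact_mod_cast c, by push_cast at b; omega⟩
  have hval : ∀ l : L, (#{x | T x l} : ℤ) = 2 * if 0 < #{x | T x l} then 1 else 0 := by
    intro l
    split_ifs with h0
    · rw [(hA l h0).2]; norm_num
    · rw [Nat.eq_zero_of_not_pos h0]; norm_num
  refine ⟨hA, ?_, ?_, ?_⟩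
  · intro l h0
    rcases Finset.eq_empty_or_nonempty ({x ∈ K | x ∈ l} : Finset P) with he | ⟨p, hp⟩
    · left; simp [he]
    · right
      have hp' := mem_filter.1 hp
      have b := h6 p hp'.1 l hp'.2
      rw [h0] at b
      push_cast at b
      omega
  · intro p hp
    have := h5 p hp
    rw [sum_congr rfl fun l _ => hval l, ← mul_sum, ← sum_filter, filter_filter, sum_const,
      nsmul_eq_mul, mul_one] at this
    have h' : (#{l : L | p ∈ l ∧ 0 < #{x | T x l}} : ℤ) = 1 := by linarith
    exact_mod_cast h'
  · rw [sum_congr rfl fun l _ => hval l, ← mul_sum, ← sum_filter, sum_const,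
      nsmul_eq_mul, mul_one] at hS
    exact_mod_cast hS

end TangentSystem

/-- If `t` is the number of lines of `B` through a point, the sums of `t` and of `t²` over the plane
depend only on `#B` and the order `q`. Summing `(t - 1)(t - 3) = 0` and inserting `#B = (3q + 2)/2`
leaves `3q(q - 4) = 0`. -/
theorem order_eq_four_of_dual_arc (B : Finset L) (hB : 2 * #B = 3 * order P L + 2)
    (ht : ∀ p : P, #{l ∈ B | p ∈ l} = 1 ∨ #{l ∈ B | p ∈ l} = 3) : order P L = 4 := by
  have s1 : ∑ p : P, (#{l ∈ B | p ∈ l} : ℤ) = #B * (order P L + 1) := by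
    have : ∑ p : P, #{l ∈ B | p ∈ l} = ∑ l ∈ B, #{p : P | p ∈ l} := by
      simp only [card_filter]
      exact sum_comm
    simp only [card_points_on, sum_const, smul_eq_mul] at this
    exact_mod_cast this
  have s2 : ∑ p : P, (#{l ∈ B | p ∈ l} : ℤ) * #{l ∈ B | p ∈ l} = #B * (#B + order P L) := by
    have : ∑ p : P, #{l ∈ B | p ∈ l} * #{l ∈ B | p ∈ l} =
        ∑ l ∈ B, ∑ p : P with p ∈ l, #{m ∈ B | p ∈ m} := by
      simp only [sum_filter]
      rw [sum_comm]
      refine sum_congr rfl fun p _ => ?_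
      rw [← sum_filter, sum_const, smul_eq_mul]
    rw [sum_congr rfl fun l hl => (sum_card_filter_points (P := P) B l).trans
      (by rw [if_pos hl]), sum_const, smul_eq_mul] at this
    exact_mod_cast this
  have s3 : ∑ p : P, (((#{l ∈ B | p ∈ l} : ℤ) * #{l ∈ B | p ∈ l} - 4 * #{l ∈ B | p ∈ l}) + 3) = 0 := by
    refine sum_eq_zero fun p _ => ?_
    rcases ht p with h | h <;> rw [h] <;> norm_num
  rw [sum_add_distrib, sum_sub_distrib, ← mul_sum, s1, s2, sum_const, card_univ,
    card_points P L] at s3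
  have hq : (1 : ℤ) < order P L := by exact_mod_cast one_lt_order P L
  zify at hB
  have : (3 * (order P L : ℤ)) * (order P L - 4) = 0 := by
    push_cast [nsmul_eq_mul] at s3
    have e : (#B : ℤ) * 2 = 3 * order P L + 2 := by linarith
    linear_combination 4 * s3 - (2 * (#B : ℤ) - 3 * order P L - 6) * e
  have h4 : (order P L : ℤ) - 4 = 0 := by
    rcases mul_eq_zero.1 this with h | h <;> linarith
  omega

/-- Such a `K` has one unisecant at each of its points, hence `q + 1` in all. If every point off `K`
were on two of them there would be more than `(q + 1)²` incidences, so some `u` off `K` is on at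
most one. -/
theorem exists_three_external_lines (hq : 5 ≤ order P L) (K : Finset P)
    (hK : #K = order P L + 1) (h2 : ∀ l : L, #{x ∈ K | x ∈ l} ≤ 2) :
    ∃ u : P, 3 ≤ #{l : L | u ∈ l ∧ #{x ∈ K | x ∈ l} = 0} := by
  have hone : ∀ p ∈ K, #{l : L | p ∈ l ∧ #{x ∈ K | x ∈ l} = 1} = 1 := by
    intro p hp
    have := sum_deficit (L := L) K 2 hp
    rw [hK] at this
    have e : ∀ l ∈ ({l : L | p ∈ l} : Finset L), (2 : ℤ) - #{x ∈ K | x ∈ l} =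
        if #{x ∈ K | x ∈ l} = 1 then 1 else 0 := by
      intro l hl
      have hpos : 0 < #{x ∈ K | x ∈ l} := card_pos.2 ⟨p, by simp_all⟩
      have := h2 l
      split_ifs with h <;> omega
    rw [sum_congr rfl e, ← sum_filter, filter_filter, sum_const, nsmul_eq_mul] at this
    push_cast at this
    have : (#{l : L | p ∈ l ∧ #{x ∈ K | x ∈ l} = 1} : ℤ) = 1 := by linarith
    exact_mod_cast this
  set B : Finset L := {l : L | #{x ∈ K | x ∈ l} = 1} with hB
  have hBt : ∀ p : P, #{l ∈ B | p ∈ l} = #{l : L | p ∈ l ∧ #{x ∈ K | x ∈ l} = 1} := by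
    intro p
    rw [hB, filter_filter]
    simp only [and_comm]
  have hBcard : #B = order P L + 1 := by
    have : ∑ p ∈ K, #{l ∈ B | p ∈ l} = ∑ l ∈ B, #{p ∈ K | p ∈ l} := by
      simp only [card_filter]
      exact sum_comm
    rw [sum_congr rfl fun p hp => (hBt p).trans (hone p hp),
      sum_congr rfl fun l (hl : l ∈ B) => (mem_filter.1 hl).2] at this
    simp only [sum_const, smul_eq_mul, mul_one] at this
    omega
  have hsum : ∑ p : P, #{l ∈ B | p ∈ l} = (order P L + 1) * (order P L + 1) := by
    have : ∑ p : P, #{l ∈ B | p ∈ l} = ∑ l ∈ B, #{p : P | p ∈ l} := by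
      simp only [card_filter]
      exact sum_comm
    rw [this]
    simp only [card_points_on, sum_const, smul_eq_mul, hBcard]
  obtain ⟨u, huK, hu⟩ : ∃ u ∉ K, #{l ∈ B | u ∈ l} ≤ 1 := by
    by_contra! hc
    rw [← sum_add_sum_compl K, sum_congr rfl fun p hp => (hBt p).trans (hone p hp)] at hsum
    have h3 : ∑ p ∈ Kᶜ, 2 ≤ ∑ p ∈ Kᶜ, #{l ∈ B | p ∈ l} :=
      sum_le_sum fun p hp => hc p (mem_compl.1 hp)
    rw [sum_const, card_compl, card_points P L, hK, smul_eq_mul] at h3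
    rw [sum_const, hK, smul_eq_mul, mul_one] at hsum
    have : order P L ^ 2 + order P L + 1 - (order P L + 1) = order P L ^ 2 := by omega
    rw [this] at h3
    nlinarith
  refine ⟨u, ?_⟩
  have h3 := sum_card_filter_lines (L := L) K u
  rw [if_neg huK, add_zero, hK] at h3
  -- Summed over the pencil at `u`, this says that twice the number of external lines is `q + 1`
  -- minus the number of unisecants, so at least `q ≥ 5`.
  have e : ∀ l : L, #{x ∈ K | x ∈ l} + 2 * (if #{x ∈ K | x ∈ l} = 0 then 1 else 0) +
      (if #{x ∈ K | x ∈ l} = 1 then 1 else 0) = 2 := by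
    intro l
    have := h2 l
    split_ifs <;> omega
  have h4 := sum_congr (rfl : ({l : L | u ∈ l} : Finset L) = _) fun l _ => e l
  rw [sum_add_distrib, sum_add_distrib, ← mul_sum, h3, ← sum_filter, ← sum_filter, filter_filter,
    filter_filter] at h4
  simp only [sum_const, smul_eq_mul, mul_one, card_lines_through] at h4
  rw [hBt] at hu
  omega

end PlaneCounting

/-! ### Restriction of forms to lines and directional derivatives. -/

noncomputable section PlaneForms

open MvPolynomial Configuration Configuration.ofField Configuration.ProjectivePlane Finset
open scoped Classical LinearAlgebra.Projectivization Matrix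

variable {k : Type*} [Field k]

theorem aeval_smul_of_isHomogeneous {σ R A : Type*} [CommSemiring R] [CommSemiring A]
    [Algebra R A] {f : MvPolynomial σ R} {d : ℕ} (hf : f.IsHomogeneous d) (c : A) (y : σ → A) :
    aeval (c • y) f = c ^ d * aeval y f := by
  rw [aeval_def, aeval_def, eval₂_eq, eval₂_eq, mul_sum]
  refine sum_congr rfl fun m hm => ?_
  simp only [Pi.smul_apply, smul_eq_mul, mul_pow, prod_mul_distrib]
  rw [prod_pow_eq_pow_sum, ← hf.degree_eq_sum_deg_support hm]
  ring

theorem eval_smul_of_isHomogeneous {σ R : Type*} [CommSemiring R]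
    {f : MvPolynomial σ R} {d : ℕ} (hf : f.IsHomogeneous d) (c : R) (y : σ → R) :
    eval (c • y) f = c ^ d * eval y f := by
  simpa [aeval_eq_eval] using aeval_smul_of_isHomogeneous hf c y

/-- The derivative of a polynomial in a constant direction. -/
def dirDeriv (f : MvPolynomial (Fin 3) k) (v : Fin 3 → k) : MvPolynomial (Fin 3) k :=
  ∑ i, C (v i) * pderiv i f

theorem dirDeriv_isHomogeneous {f : MvPolynomial (Fin 3) k} {d : ℕ} (hf : f.IsHomogeneous d)
    (v : Fin 3 → k) : (dirDeriv f v).IsHomogeneous (d - 1) :=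
  IsHomogeneous.sum _ _ _ fun i _ => (hf.pderiv (i := i)).C_mul (v i)

theorem eval_dirDeriv (f : MvPolynomial (Fin 3) k) (v y : Fin 3 → k) :
    eval y (dirDeriv f v) = ∑ i, v i * eval y (pderiv i f) := by
  simp [dirDeriv]

theorem eval_dirDeriv_self {f : MvPolynomial (Fin 3) k} {d : ℕ} (hf : f.IsHomogeneous d)
    (y : Fin 3 → k) : eval y (dirDeriv f y) = d * eval y f := by
  have := congrArg (eval y) hf.sum_X_mul_pderiv
  simpa [eval_dirDeriv] using this

theorem eval_dirDeriv_add_smul (f : MvPolynomial (Fin 3) k) (v w y : Fin 3 → k) (s t : k) :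
    eval y (dirDeriv f (s • v + t • w)) =
      s * eval y (dirDeriv f v) + t * eval y (dirDeriv f w) := by
  simp only [eval_dirDeriv, mul_sum, ← sum_add_distrib]
  refine sum_congr rfl fun i _ => ?_
  simp only [Pi.add_apply, Pi.smul_apply, smul_eq_mul]
  ring

/-- The restriction of a polynomial to the affine line through `a` in the direction `b`. -/
def lineRestrict (f : MvPolynomial (Fin 3) k) (a b : Fin 3 → k) : Polynomial k :=
  aeval (fun i => Polynomial.C (a i) + Polynomial.C (b i) * Polynomial.X) f

theorem eval_lineRestrict (f : MvPolynomial (Fin 3) k) (a b : Fin 3 → k) (t : k) :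
    (lineRestrict f a b).eval t = eval (a + t • b) f := by
  rw [lineRestrict, ← Polynomial.coe_evalRingHom, aeval_def, hom_eval₂]
  have e1 : (Polynomial.evalRingHom t).comp (algebraMap k (Polynomial k)) = RingHom.id k := by
    ext; simp
  rw [e1, eval, coe_eval₂Hom]
  congr 1
  ext i
  simp only [Polynomial.coe_evalRingHom, Polynomial.eval_add, Polynomial.eval_mul,
    Polynomial.eval_C, Polynomial.eval_X, Pi.add_apply, Pi.smul_apply, smul_eq_mul]
  ring

theorem derivative_aeval (g : Fin 3 → Polynomial k) (f : MvPolynomial (Fin 3) k) :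
    Polynomial.derivative (aeval g f) =
      ∑ i, Polynomial.derivative (g i) * aeval g (pderiv i f) := by
  induction f using MvPolynomial.induction_on with
  | C a => simp
  | add p q hp hq => simp only [map_add, hp, hq, mul_add, sum_add_distrib]
  | mul_X p j hp =>
    simp only [map_mul, aeval_X, Polynomial.derivative_mul, hp, Derivation.leibniz, smul_eq_mul,
      map_add, mul_add, sum_add_distrib, pderiv_X]
    have : ∀ i, (aeval g) ((Pi.single i 1 : Fin 3 → MvPolynomial (Fin 3) k) j) =
        if i = j then 1 else 0 := by
      intro i
      by_cases h : i = j
      · subst h; simp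
      · rw [Pi.single_eq_of_ne (Ne.symm h), if_neg h, map_zero]
    simp only [this, mul_ite, mul_one, mul_zero, sum_ite_eq', mem_univ, if_true, sum_mul]
    rw [add_comm, mul_comm]
    congr 1
    exact sum_congr rfl fun i _ => by ring

theorem eval_derivative_lineRestrict (f : MvPolynomial (Fin 3) k) (a b : Fin 3 → k) (t : k) :
    (lineRestrict f a b).derivative.eval t = eval (a + t • b) (dirDeriv f b) := by
  rw [lineRestrict, derivative_aeval, Polynomial.eval_finsetSum, eval_dirDeriv]
  refine sum_congr rfl fun i _ => ?_
  rw [← eval_lineRestrict, lineRestrict]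
  simp

theorem natDegree_lineRestrict_monomial (m : Fin 3 →₀ ℕ) (c : k) (a b : Fin 3 → k) :
    (lineRestrict (monomial m c) a b).natDegree ≤ m.degree ∧
    (lineRestrict (monomial m c) a b).coeff m.degree = eval b (monomial m c) := by
  have h1 : ∀ i, (Polynomial.C (a i) + Polynomial.C (b i) * Polynomial.X).natDegree ≤ 1 :=
    fun i => by compute_degree
  have h2 : ∀ i, ((Polynomial.C (a i) + Polynomial.C (b i) * Polynomial.X) ^ m i).natDegree ≤ m i :=
    fun i => (Polynomial.natDegree_pow_le_of_le _ (h1 i)).trans (by simp)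
  have h3 : ∀ i, ((Polynomial.C (a i) + Polynomial.C (b i) * Polynomial.X) ^ m i).coeff (m i) =
      b i ^ m i := fun i => by
    have := Polynomial.coeff_pow_of_natDegree_le (n := 1) (m := m i) (h1 i)
    simpa using this
  have hd : m.degree = 0 + (m 0 + m 1 + m 2) := by
    rw [Finsupp.degree_eq_sum, Fin.sum_univ_three, zero_add]
  rw [lineRestrict, aeval_monomial, eval_monomial, Finsupp.prod_fintype _ _ (by simp),
    Finsupp.prod_fintype _ _ (by simp), Fin.prod_univ_three, Fin.prod_univ_three, hd]
  have d01 := Polynomial.natDegree_mul_le_of_le (h2 0) (h2 1)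
  have d012 := Polynomial.natDegree_mul_le_of_le d01 (h2 2)
  have dC : (algebraMap k (Polynomial k) c).natDegree ≤ 0 := by simp
  refine ⟨Polynomial.natDegree_mul_le_of_le dC d012, ?_⟩
  rw [Polynomial.coeff_mul_add_eq_of_natDegree_le dC d012,
    Polynomial.coeff_mul_add_eq_of_natDegree_le d01 (h2 2), Polynomial.coeff_mul_add_eq_of_natDegree_le (h2 0) (h2 1),
    h3, h3, h3]
  simp

/-- The top coefficient is the value at the point at infinity `b` of the line, so the restriction is
nonzero as soon as `f` does not vanish at `b`. -/
theorem lineRestrict_degree {f : MvPolynomial (Fin 3) k} {d : ℕ} (hf : f.IsHomogeneous d)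
    (a b : Fin 3 → k) :
    (lineRestrict f a b).natDegree ≤ d ∧ (lineRestrict f a b).coeff d = eval b f := by
  have e : lineRestrict f a b = ∑ m ∈ f.support, lineRestrict (monomial m (f.coeff m)) a b := by
    conv_lhs => rw [f.as_sum]
    simp only [lineRestrict, map_sum]
  have hdeg : ∀ m ∈ f.support, m.degree = d := fun m hm => by
    by_contra h
    exact (mem_support_iff.1 hm) (hf.coeff_eq_zero h)
  rw [e]
  constructor
  · exact Polynomial.natDegree_sum_le_of_forall_le _ _ fun m hm =>
      hdeg m hm ▸ (natDegree_lineRestrict_monomial m _ a b).1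
  · rw [Polynomial.finsetSum_coeff]
    conv_rhs => rw [f.as_sum, map_sum]
    exact sum_congr rfl fun m hm => hdeg m hm ▸ (natDegree_lineRestrict_monomial m _ a b).2

/-- Three vectors orthogonal to `w ≠ 0` have determinant zero; in a linear relation among them, the
coefficient of `y` is nonzero by independence of `a` and `b`. -/
theorem exists_combination_of_orthogonal {w a b y : Fin 3 → k} (hw : w ≠ 0) (ha : a ⬝ᵥ w = 0)
    (hb : b ⬝ᵥ w = 0) (hy : y ⬝ᵥ w = 0) (hab : ∀ s t : k, s • a + t • b = 0 → s = 0 ∧ t = 0) :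
    ∃ s t : k, y = s • a + t • b := by
  have h0 : (Matrix.of ![a, b, y]).det = 0 := by
    refine Matrix.exists_mulVec_eq_zero_iff.1 ⟨w, hw, ?_⟩
    ext i
    fin_cases i <;> simpa [Matrix.mulVec]
  obtain ⟨v, hv, hv0⟩ := Matrix.exists_vecMul_eq_zero_iff.2 h0
  have e : v 0 • a + v 1 • b + v 2 • y = 0 := by
    rw [← hv0]
    ext j
    simp [Matrix.vecMul, dotProduct, Fin.sum_univ_three]
  have h2 : v 2 ≠ 0 := by
    intro h2
    rw [h2, zero_smul, add_zero] at e
    obtain ⟨h00, h01⟩ := hab _ _ e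
    exact hv (by ext i; fin_cases i <;> assumption)
  refine ⟨-(v 2)⁻¹ * v 0, -(v 2)⁻¹ * v 1, ?_⟩
  ext j
  have := congrFun e j
  simp only [Pi.add_apply, Pi.smul_apply, smul_eq_mul, Pi.zero_apply] at this ⊢
  field_simp
  linear_combination this

theorem proj_mem_iff {p l : ℙ k (Fin 3 → k)} : p ∈ l ↔ p.rep ⬝ᵥ l.rep = 0 := by
  rw [mem_iff]
  conv_lhs => rw [← p.mk_rep, ← l.mk_rep]
  exact Projectivization.orthogonal_mk _ _

theorem mk_mem_iff {v : Fin 3 → k} (hv : v ≠ 0) {l : ℙ k (Fin 3 → k)} :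
    Projectivization.mk k v hv ∈ l ↔ v ⬝ᵥ l.rep = 0 := by
  rw [mem_iff]
  conv_lhs => rw [← l.mk_rep]
  exact Projectivization.orthogonal_mk _ _

theorem independent_of_ne {p p' : ℙ k (Fin 3 → k)} (h : p ≠ p') (s t : k)
    (e : s • p.rep + t • p'.rep = 0) : s = 0 ∧ t = 0 := by
  have key : ∀ {p p' : ℙ k (Fin 3 → k)} {s t : k}, p ≠ p' → s • p.rep + t • p'.rep = 0 → s = 0 := by
    intro p p' s t h e
    by_contra hs
    apply h
    rw [← p.mk_rep, ← p'.mk_rep, Projectivization.mk_eq_mk_iff']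
    refine ⟨-s⁻¹ * t, ?_⟩
    ext j
    have := congrFun e j
    simp only [Pi.add_apply, Pi.smul_apply, smul_eq_mul, Pi.zero_apply] at this ⊢
    field_simp
    linear_combination -this
  exact ⟨key h e, key h.symm (by rwa [add_comm])⟩

/-- An affine coordinate on `l` with `p₀` at infinity. -/
theorem exists_param {l p₀ p₁ p : ℙ k (Fin 3 → k)} (h₀ : p₀ ∈ l) (h₁ : p₁ ∈ l) (hp : p ∈ l)
    (h : p₁ ≠ p₀) (hne : p ≠ p₀) :
    ∃ c t : k, c ≠ 0 ∧ p.rep = c • (p₁.rep + t • p₀.rep) := by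
  obtain ⟨s, t, e⟩ := exists_combination_of_orthogonal l.rep_nonzero (proj_mem_iff.1 h₁)
    (proj_mem_iff.1 h₀) (proj_mem_iff.1 hp) (independent_of_ne h)
  have hs : s ≠ 0 := by
    rintro rfl
    have := independent_of_ne hne 1 (-t) (by rw [e]; simp)
    exact one_ne_zero this.1
  refine ⟨s, s⁻¹ * t, hs, ?_⟩
  rw [e, smul_add, smul_smul, mul_inv_cancel_left₀ hs]

end PlaneForms

/-! ### Rational zeros of forms and their tangent lines. -/

noncomputable section PlaneZeros

open MvPolynomial Configuration Configuration.ofField Configuration.ProjectivePlane Finset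
open scoped Classical LinearAlgebra.Projectivization Matrix

set_option linter.unusedSectionVars false

section Homogeneous

variable {σ R A : Type*} [CommRing R] [CommRing A] [Algebra R A]

/-- The substitution `X i ↦ c i * T`. -/
def scaleHom (c : σ → A) : MvPolynomial σ R →ₐ[R] Polynomial A :=
  aeval fun i => Polynomial.C (c i) * Polynomial.X

theorem scaleHom_of_isHomogeneous (c : σ → A) {f : MvPolynomial σ R} {n : ℕ}
    (hf : f.IsHomogeneous n) :
    scaleHom c f = Polynomial.C (aeval c f) * Polynomial.X ^ n := by
  have e : (fun i => Polynomial.C (c i) * Polynomial.X) =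
      (Polynomial.X : Polynomial A) • fun i => Polynomial.C (c i) := by
    ext1 i
    exact mul_comm _ _
  rw [scaleHom, e, aeval_smul_of_isHomogeneous hf, mul_comm]
  congr 1
  exact aeval_algebraMap_apply (Polynomial A) c f

theorem coeff_scaleHom (c : σ → A) (f : MvPolynomial σ R) (n : ℕ) :
    (scaleHom c f).coeff n = aeval c (homogeneousComponent n f) := by
  conv_lhs => rw [← sum_homogeneousComponent f, map_sum]
  simp only [scaleHom_of_isHomogeneous c (homogeneousComponent_isHomogeneous _ f),
    Polynomial.finsetSum_coeff, Polynomial.coeff_C_mul_X_pow]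
  rw [sum_ite_eq, ite_eq_left_iff]
  intro h
  rw [homogeneousComponent_eq_zero n f (by simpa using h), map_zero]

/-- Under `X i ↦ X i * T` a form becomes a monomial in `T`. Over a domain both the degree and the
trailing degree in `T` are additive, so they agree on each factor of a nonzero monomial. -/
theorem exists_isHomogeneous_of_mul [IsDomain R] {a b : MvPolynomial σ R} {n : ℕ}
    (hab : (a * b).IsHomogeneous n) (h0 : a * b ≠ 0) : ∃ i, a.IsHomogeneous i := by
  set φ : MvPolynomial σ R →ₐ[R] Polynomial (MvPolynomial σ R) := scaleHom X with hφ
  have hc : ∀ f i, (φ f).coeff i = homogeneousComponent i f := fun f i => by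
    rw [hφ, coeff_scaleHom, aeval_X_left_apply]
  have hinj : ∀ f, f ≠ 0 → φ f ≠ 0 := fun f hf h => hf (by
    rw [← sum_homogeneousComponent f]
    exact sum_eq_zero fun i _ => by rw [← hc, h, Polynomial.coeff_zero])
  have hprod : φ a * φ b = Polynomial.monomial n (a * b) := by
    rw [← map_mul, hφ, scaleHom_of_isHomogeneous _ hab, aeval_X_left_apply,
      Polynomial.C_mul_X_pow_eq_monomial]
  have ha := hinj a (left_ne_zero_of_mul h0)
  have hb := hinj b (right_ne_zero_of_mul h0)
  have h1 := Polynomial.natDegree_mul ha hb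
  have h2 := Polynomial.natTrailingDegree_mul ha hb
  rw [hprod, Polynomial.natDegree_monomial_eq n h0] at h1
  rw [hprod, Polynomial.natTrailingDegree_monomial h0] at h2
  have h3 := Polynomial.natTrailingDegree_le_natDegree (φ a)
  have h4 := Polynomial.natTrailingDegree_le_natDegree (φ b)
  refine ⟨(φ a).natDegree, ?_⟩
  refine (congrArg (fun f => IsHomogeneous f (φ a).natDegree) (sum_homogeneousComponent a)).mp ?_
  refine IsHomogeneous.sum _ _ _ fun i _ => ?_
  rcases eq_or_ne i (φ a).natDegree with rfl | hi
  · exact homogeneousComponent_isHomogeneous _ _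
  · rw [← hc]
    rcases lt_or_gt_of_ne hi with hi | hi
    · rw [Polynomial.coeff_eq_zero_of_lt_natTrailingDegree (by omega)]
      exact isHomogeneous_zero _ _ _
    · rw [Polynomial.coeff_eq_zero_of_natDegree_lt hi]
      exact isHomogeneous_zero _ _ _

theorem isHomogeneous_of_mul [IsDomain R] {a b : MvPolynomial σ R} {n m : ℕ}
    (hab : (a * b).IsHomogeneous (m + n)) (h0 : a * b ≠ 0) (ha : a.IsHomogeneous m) :
    b.IsHomogeneous n := by
  obtain ⟨i, hi⟩ := exists_isHomogeneous_of_mul (a := b) (b := a) (by rwa [mul_comm])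
    (by rwa [mul_comm])
  have := hab.inj_right (ha.mul hi) h0
  rwa [show n = i by omega]

end Homogeneous

variable {k : Type*} [Field k] [Fintype k]

instance : Fintype (ℙ k (Fin 3 → k)) := Fintype.ofFinite _

theorem card_projectivePlane :
    Fintype.card (ℙ k (Fin 3 → k)) = Fintype.card k ^ 2 + Fintype.card k + 1 := by
  have := Projectivization.card_of_finrank k (Fin 3 → k) (n := 3) (by simp)
  rw [Nat.card_eq_fintype_card, Nat.card_eq_fintype_card] at this
  rw [this]
  simp [sum_range_succ]
  ring

theorem order_projectivePlane :
    order (ℙ k (Fin 3 → k)) (ℙ k (Fin 3 → k)) = Fintype.card k := by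
  have h1 := card_points (ℙ k (Fin 3 → k)) (ℙ k (Fin 3 → k))
  rw [card_projectivePlane] at h1
  nlinarith

/-- The rational zeros in the projective plane of a form. -/
def zeros (f : MvPolynomial (Fin 3) k) : Finset (ℙ k (Fin 3 → k)) :=
  {p | eval p.rep f = 0}

theorem mem_zeros {f : MvPolynomial (Fin 3) k} {p : ℙ k (Fin 3 → k)} :
    p ∈ zeros f ↔ eval p.rep f = 0 := by
  simp [zeros]

theorem eval_smul_eq_zero_iff {f : MvPolynomial (Fin 3) k} {d : ℕ} (hf : f.IsHomogeneous d)
    {c : k} (hc : c ≠ 0) (y : Fin 3 → k) : eval (c • y) f = 0 ↔ eval y f = 0 := by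
  rw [eval_smul_of_isHomogeneous hf, mul_eq_zero, or_iff_right (pow_ne_zero _ hc)]

theorem mk_mem_zeros {f : MvPolynomial (Fin 3) k} {d : ℕ} (hf : f.IsHomogeneous d)
    {v : Fin 3 → k} (hv : v ≠ 0) : Projectivization.mk k v hv ∈ zeros f ↔ eval v f = 0 := by
  obtain ⟨a, ha⟩ := Projectivization.exists_smul_eq_mk_rep k v hv
  rw [mem_zeros, ← ha]
  exact eval_smul_eq_zero_iff hf a.ne_zero v

/-- The line `l` is tangent at its point `p` to the curve with equation `f = 0`. -/
def IsTangentAt (f : MvPolynomial (Fin 3) k) (p l : ℙ k (Fin 3 → k)) : Prop :=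
  p ∈ zeros f ∧ p ∈ l ∧ ∀ v : Fin 3 → k, v ⬝ᵥ l.rep = 0 → eval p.rep (dirDeriv f v) = 0

/-- The gradAt of `f` at the representative of `p`. -/
def gradAt (f : MvPolynomial (Fin 3) k) (p : ℙ k (Fin 3 → k)) : Fin 3 → k :=
  fun i => eval p.rep (pderiv i f)

theorem eval_rep_dirDeriv (f : MvPolynomial (Fin 3) k) (p : ℙ k (Fin 3 → k)) (v : Fin 3 → k) :
    eval p.rep (dirDeriv f v) = v ⬝ᵥ gradAt f p := by
  rw [eval_dirDeriv]
  rfl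

/-- At a singular point any line through `p` will do. Otherwise the line has the gradient as
coordinates, and it passes through `p` by Euler's identity. -/
theorem exists_isTangentAt {f : MvPolynomial (Fin 3) k} {d : ℕ} (hf : f.IsHomogeneous d)
    {p : ℙ k (Fin 3 → k)} (hp : p ∈ zeros f) : ∃ l, IsTangentAt f p l := by
  by_cases h : gradAt f p = 0
  · obtain ⟨l, hl⟩ := card_pos.1 (by rw [card_lines_through (L := ℙ k (Fin 3 → k)) p]; omega)
    exact ⟨l, hp, by simpa using hl, fun v _ => by rw [eval_rep_dirDeriv, h, dotProduct_zero]⟩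
  · have key : ∀ v : Fin 3 → k, v ⬝ᵥ (Projectivization.mk k _ h).rep = 0 ↔
        v ⬝ᵥ gradAt f p = 0 := by
      intro v
      obtain ⟨a, ha⟩ := Projectivization.exists_smul_eq_mk_rep k _ h
      rw [← ha, Units.smul_def, dotProduct_smul, smul_eq_mul, mul_eq_zero,
        or_iff_right a.ne_zero]
    refine ⟨Projectivization.mk k _ h, hp, ?_, fun v hv => ?_⟩
    · rw [proj_mem_iff, key, ← eval_rep_dirDeriv, eval_dirDeriv_self hf, mem_zeros.1 hp, mul_zero]
    · rw [eval_rep_dirDeriv, ← key, hv]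

theorem exists_ne_mem_line (p l : ℙ k (Fin 3 → k)) : ∃ p' ∈ l, p' ≠ p := by
  have h := card_points_on (P := ℙ k (Fin 3 → k)) l
  have h1 := one_lt_order (ℙ k (Fin 3 → k)) (ℙ k (Fin 3 → k))
  obtain ⟨p', hp', hne⟩ := exists_mem_ne (s := {p | p ∈ l}) (by omega) p
  exact ⟨p', by simpa using hp', hne⟩

/-- A root which is also a root of the derivative has multiplicity at least two. -/
theorem sum_multiplicity_le (g : Polynomial k) (hg : g ≠ 0) :
    #g.roots.toFinset + #{t ∈ g.roots.toFinset | g.derivative.eval t = 0} ≤ g.natDegree := by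
  refine le_trans ?_ (Polynomial.card_roots' g)
  rw [← Multiset.toFinset_sum_count_eq, card_eq_sum_ones, card_filter, ← sum_add_distrib]
  refine sum_le_sum fun t ht => ?_
  rw [Polynomial.count_roots]
  have hr : g.IsRoot t := (Polynomial.mem_roots hg).1 (Multiset.mem_toFinset.1 ht)
  split_ifs with h
  · exact (Polynomial.one_lt_rootMultiplicity_iff_isRoot hg).2 ⟨hr, h⟩
  · exact (Polynomial.rootMultiplicity_pos hg).2 hr

/-- With the nonzero `p₀` at infinity, `f` restricts to a nonzero polynomial of degree at most `d`,
whose roots include the zeros of `f` on `l`, with multiplicity at least two at points of tangency.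
-/
theorem card_add_card_tangent_le {f : MvPolynomial (Fin 3) k} {d : ℕ} (hf : f.IsHomogeneous d)
    {p₀ l : ℙ k (Fin 3 → k)} (h₀ : p₀ ∈ l) (h₀f : p₀ ∉ zeros f) :
    #{x ∈ zeros f | x ∈ l} + #{x | IsTangentAt f x l} ≤ d := by
  obtain ⟨p₁, h₁, hne⟩ := exists_ne_mem_line p₀ l
  set g := lineRestrict f p₁.rep p₀.rep with hgdef
  obtain ⟨hdeg, hcoeff⟩ := lineRestrict_degree hf p₁.rep p₀.rep
  have hg : g ≠ 0 := by
    intro h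
    rw [← hgdef, h, Polynomial.coeff_zero] at hcoeff
    exact h₀f (mem_zeros.2 hcoeff.symm)
  -- The value `p₀` is only a default; the vector is nonzero at the parameters used.
  set φ : k → ℙ k (Fin 3 → k) := fun t =>
    if h : p₁.rep + t • p₀.rep ≠ 0 then Projectivization.mk k _ h else p₀ with hφ
  have hpar : ∀ x ∈ zeros f, x ∈ l → ∃ t ∈ g.roots.toFinset, φ t = x ∧
      (IsTangentAt f x l → g.derivative.eval t = 0) := by
    intro x hx hxl
    have hx0 : x ≠ p₀ := fun h => h₀f (h ▸ hx)
    obtain ⟨c, t, hc, e⟩ := exists_param h₀ h₁ hxl hne hx0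
    have hne0 : p₁.rep + t • p₀.rep ≠ 0 := by
      intro h
      rw [h, smul_zero] at e
      exact x.rep_nonzero e
    refine ⟨t, ?_, ?_, fun hT => ?_⟩
    · rw [Multiset.mem_toFinset, Polynomial.mem_roots hg, Polynomial.IsRoot, eval_lineRestrict,
        ← eval_smul_eq_zero_iff hf hc, ← e]
      exact mem_zeros.1 hx
    · simp only [hφ, dif_pos hne0]
      rw [← x.mk_rep, Projectivization.mk_eq_mk_iff']
      refine ⟨c⁻¹, ?_⟩
      rw [e, smul_smul, inv_mul_cancel₀ hc, one_smul]
    · rw [eval_derivative_lineRestrict,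
        ← eval_smul_eq_zero_iff (dirDeriv_isHomogeneous hf _) hc, ← e]
      exact hT.2.2 _ (proj_mem_iff.1 h₀)
  refine le_trans (add_le_add ?_ ?_) ((sum_multiplicity_le g hg).trans hdeg)
  · refine (card_le_card (t := g.roots.toFinset.image φ) fun x hx => ?_).trans card_image_le
    obtain ⟨t, ht, e, -⟩ := hpar x (mem_filter.1 hx).1 (mem_filter.1 hx).2
    exact mem_image.2 ⟨t, ht, e⟩
  · refine (card_le_card (t := ({t ∈ g.roots.toFinset | g.derivative.eval t = 0}).image φ)
      fun x hx => ?_).trans card_image_le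
    have hT : IsTangentAt f x l := by simpa using hx
    obtain ⟨t, ht, e, h⟩ := hpar x hT.1 hT.2.1
    exact mem_image.2 ⟨t, mem_filter.2 ⟨ht, h hT⟩, e⟩

/-- The plane curve with equation `f = 0` contains all rational points of no rational line. -/
def ContainsNoLine (f : MvPolynomial (Fin 3) k) : Prop :=
  ∀ l : ℙ k (Fin 3 → k), ∃ p ∈ l, p ∉ zeros f

theorem tangentSystem {f : MvPolynomial (Fin 3) k} {d : ℕ} (hf : f.IsHomogeneous d)
    (hl : ContainsNoLine f) : TangentSystem (zeros f) (IsTangentAt f) d where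
  mem _ _ h := ⟨h.1, h.2.1⟩
  exists_tangent _ hp := exists_isTangentAt hf hp
  card_add_card_le l := by
    obtain ⟨p, hp, hp'⟩ := hl l
    exact card_add_card_tangent_le hf hp hp'

theorem card_zeros_le {f : MvPolynomial (Fin 3) k} {d : ℕ} (hf : f.IsHomogeneous d)
    (hl : ContainsNoLine f) (hd : 0 < d) :
    2 * #(zeros f) ≤ 2 * (d - 1) * Fintype.card k + d := by
  rw [← order_projectivePlane]
  exact (tangentSystem hf hl).two_mul_card_le hd

end PlaneZeros

/-! ### A quartic without rational lines has at most `3q + 1` rational points. -/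

noncomputable section QuarticBound

open MvPolynomial Configuration Configuration.ofField Configuration.ProjectivePlane Finset
open scoped Classical LinearAlgebra.Projectivization Matrix

set_option linter.unusedSectionVars false

variable {k : Type*} [Field k] [Fintype k]

/-- In characteristic `2` the derivative of a quartic in one variable has the form `c₁ + c₃t²`. It
vanishes at the parameters `0` and `t ≠ 0` of the two points of tangency, so `c₁ = c₃ = 0`. At `u`
itself Euler's identity gives the factor `4 = 0`. -/
theorem eval_dirDeriv_of_isTangentAt {f : MvPolynomial (Fin 3) k} {d : ℕ} (hf : f.IsHomogeneous d)
    (h2 : (2 : k) = 0) (hd : d = 4) {u l x₁ x₂ : ℙ k (Fin 3 → k)} (hu : u ∉ zeros f) (hul : u ∈ l)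
    (h₁ : IsTangentAt f x₁ l) (h₂ : IsTangentAt f x₂ l) (hne : x₁ ≠ x₂)
    {y : ℙ k (Fin 3 → k)} (hy : y ∈ l) : eval y.rep (dirDeriv f u.rep) = 0 := by
  subst hd
  rcases eq_or_ne y u with rfl | hyu
  · rw [eval_dirDeriv_self hf, show ((4 : ℕ) : k) = 2 * 2 by norm_num, h2, zero_mul, zero_mul]
  have h4 : ∀ t : k, (lineRestrict f x₁.rep u.rep).derivative.eval t =
      (lineRestrict f x₁.rep u.rep).coeff 1 + (lineRestrict f x₁.rep u.rep).coeff 3 * t ^ 2 := by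
    intro t
    rw [Polynomial.derivative_eval, Polynomial.sum_over_range' _ (by simp) 5
      (by have := (lineRestrict_degree hf x₁.rep u.rep).1; omega)]
    simp only [sum_range_succ, sum_range_zero]
    push_cast
    linear_combination ((lineRestrict f x₁.rep u.rep).coeff 2 * t +
      (lineRestrict f x₁.rep u.rep).coeff 3 * t ^ 2 +
      2 * (lineRestrict f x₁.rep u.rep).coeff 4 * t ^ 3) * h2
  have hx₁ : x₁ ≠ u := fun h => hu (h ▸ h₁.1)
  have hx₂ : x₂ ≠ u := fun h => hu (h ▸ h₂.1)
  have hD := dirDeriv_isHomogeneous hf u.rep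
  obtain ⟨c, t, hc, e⟩ := exists_param hul h₁.2.1 h₂.2.1 hx₁ hx₂
  obtain ⟨c', t', hc', e'⟩ := exists_param hul h₁.2.1 hy hx₁ hyu
  have z₁ := h₁.2.2 _ (proj_mem_iff.1 hul)
  have z₂ := h₂.2.2 _ (proj_mem_iff.1 hul)
  rw [e, eval_smul_eq_zero_iff hD hc, ← eval_derivative_lineRestrict, h4] at z₂
  have z₁' := h4 0
  rw [eval_derivative_lineRestrict, zero_smul, add_zero, z₁] at z₁'
  have ht : t ≠ 0 := by
    rintro rfl
    rw [zero_smul, add_zero] at e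
    apply hne
    rw [← x₁.mk_rep, ← x₂.mk_rep, Projectivization.mk_eq_mk_iff']
    exact ⟨c⁻¹, by rw [e, smul_smul, inv_mul_cancel₀ hc, one_smul]⟩
  have c1 : (lineRestrict f x₁.rep u.rep).coeff 1 = 0 := by linear_combination -z₁'
  have c3 : (lineRestrict f x₁.rep u.rep).coeff 3 = 0 := by
    rw [c1, zero_add] at z₂
    exact (mul_eq_zero.1 z₂).resolve_right (pow_ne_zero _ ht)
  rw [e', eval_smul_eq_zero_iff hD hc', ← eval_derivative_lineRestrict, h4, c1, c3]
  ring

theorem exists_line_not_mem {y u : ℙ k (Fin 3 → k)} (h : y ≠ u) :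
    ∃ m : ℙ k (Fin 3 → k), y ∈ m ∧ u ∉ m := by
  by_contra! hc
  have h1 := card_lines_through (L := ℙ k (Fin 3 → k)) y
  have h2 := card_lines_through_two (L := ℙ k (Fin 3 → k)) h
  have : ({l | y ∈ l} : Finset (ℙ k (Fin 3 → k))) =
      ({l | y ∈ l ∧ u ∈ l} : Finset (ℙ k (Fin 3 → k))) := by
    ext l
    simpa using hc l
  rw [this, h2] at h1
  have := one_lt_order (ℙ k (Fin 3 → k)) (ℙ k (Fin 3 → k))
  omega

/-- A cubic curve containing four rational lines through `u` vanishes at all rational points. -/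
theorem mem_zeros_of_four_lines {g : MvPolynomial (Fin 3) k} (hg : g.IsHomogeneous 3)
    {u : ℙ k (Fin 3 → k)} (B : Finset (ℙ k (Fin 3 → k))) (hB : 4 ≤ #B) (hu : ∀ l ∈ B, u ∈ l)
    (hBg : ∀ l ∈ B, ∀ y, y ∈ l → y ∈ zeros g) {y : ℙ k (Fin 3 → k)} (hy : y ≠ u) :
    y ∈ zeros g := by
  by_contra hyg
  -- A line through `y` but not `u` meets the lines of `B` in distinct zeros of `g`. It would have
  -- at least four of them, although the cubic `g` does not vanish at its point `y`.
  obtain ⟨m, hym, hum⟩ := exists_line_not_mem hy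
  have hle := card_add_card_tangent_le hg hym hyg
  have hmeet : ∀ l : ℙ k (Fin 3 → k), ∃ p, l ∈ B → p ∈ l ∧ p ∈ m := by
    intro l
    by_cases hl : l ∈ B
    · have hlm : l ≠ m := fun h => hum (h ▸ hu l hl)
      obtain ⟨p, hp, -⟩ := HasPoints.existsUnique_point (ℙ k (Fin 3 → k)) _ l m hlm
      exact ⟨p, fun _ => hp⟩
    · exact ⟨u, fun h => absurd h hl⟩
  choose φ hφ using hmeet
  have : #B ≤ #{x ∈ zeros g | x ∈ m} := by
    refine card_le_card_of_injOn φ (fun l hl => ?_) fun l hl l' hl' h => ?_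
    · have := hφ l hl
      simpa using ⟨hBg l hl _ this.1, this.2⟩
    · refine (Nondegenerate.eq_or_eq (hφ l hl).1 (hu l hl) (h ▸ (hφ l' hl').1)
        (hu l' hl')).resolve_left fun e => hum (e ▸ (hφ l hl).2)
  omega

theorem four_dvd_card_of_even (hq : 5 ≤ Fintype.card k) (he : 2 ∣ Fintype.card k) :
    4 ∣ Fintype.card k ∧ (2 : k) = 0 := by
  obtain ⟨p, hp⟩ := CharP.exists k
  obtain ⟨n, hpr, hn⟩ := FiniteField.card k p
  rw [hn] at he
  have h2p : 2 ∣ p := Nat.prime_two.dvd_of_dvd_pow he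
  obtain rfl : 2 = p := (Nat.prime_dvd_prime_iff_eq Nat.prime_two hpr).1 h2p
  refine ⟨?_, by exact_mod_cast CharP.cast_eq_zero k 2⟩
  rw [hn] at hq ⊢
  have : 2 ≤ (n : ℕ) := by
    by_contra! h
    have : (2 : ℕ) ^ (n : ℕ) ≤ 2 ^ 1 := Nat.pow_le_pow_right (by norm_num) (by omega)
    omega
  exact pow_dvd_pow 2 this

/-- In the extremal case the tangent lines are bitangents, exactly one through each point of the
curve. It is shown that every point of the plane is on one or three of them, which
`order_eq_four_of_dual_arc` excludes. -/
theorem card_zeros_quartic_le {f : MvPolynomial (Fin 3) k} (hf : f.IsHomogeneous 4)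
    (hl : ContainsNoLine f) (hq : 5 ≤ Fintype.card k) :
    #(zeros f) ≤ 3 * Fintype.card k + 1 := by
  by_contra! hlt
  have hb := card_zeros_le hf hl (by norm_num)
  have hT := tangentSystem hf hl
  have hord := order_projectivePlane (k := k)
  have hK : #(zeros f) = 3 * order (ℙ k (Fin 3 → k)) (ℙ k (Fin 3 → k)) + 2 := by
    rw [hord]; omega
  obtain ⟨h1, h2, h3, h4⟩ := hT.extremal_four hK
  rw [hord] at hK
  -- Twice the number of bitangents is `3q + 2`, so `q` is even.
  obtain ⟨hq4, hchar⟩ := four_dvd_card_of_even hq (k := k) (by omega)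
  set B : Finset (ℙ k (Fin 3 → k)) := {l | 0 < #{x | IsTangentAt f x l}} with hBdef
  have hBt : ∀ u : ℙ k (Fin 3 → k), #{l ∈ B | u ∈ l} =
      #{l : ℙ k (Fin 3 → k) | u ∈ l ∧ 0 < #{x | IsTangentAt f x l}} := by
    intro u
    rw [hBdef, filter_filter]
    simp only [and_comm]
  have hfew : ∀ u ∉ zeros f, #{l ∈ B | u ∈ l} ≤ 3 := by
    intro u hu
    by_contra! h
    -- The derivative in the direction `u` is a cubic vanishing on four bitangents through `u`,
    -- hence at every other rational point. Then each line joining `u` to a point of the curve is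
    -- tangent there, so has only two points of it, and the pencil at `u` accounts for at most `2(q
    -- + 1) < 3q + 2` points.
    have hzero : ∀ y ∈ zeros f, y ∈ zeros (dirDeriv f u.rep) := by
      intro y hy
      refine mem_zeros_of_four_lines (dirDeriv_isHomogeneous hf _) {l ∈ B | u ∈ l} h
        (fun l hl => (mem_filter.1 hl).2) (fun l hl y hyl => ?_) (fun e => hu (e ▸ hy))
      have hl' := mem_filter.1 hl
      obtain ⟨x₁, x₂, hne, e⟩ := card_eq_two.1 (h1 l (by simpa [hBdef] using hl'.1)).2
      have t₁ : x₁ ∈ ({x | IsTangentAt f x l} : Finset _) := by rw [e]; simp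
      have t₂ : x₂ ∈ ({x | IsTangentAt f x l} : Finset _) := by rw [e]; simp
      exact mem_zeros.2 (eval_dirDeriv_of_isTangentAt hf hchar rfl hu hl'.2 (by simpa using t₁)
        (by simpa using t₂) hne hyl)
    have htwo : ∀ l ∈ ({l | u ∈ l} : Finset (ℙ k (Fin 3 → k))), #{x ∈ zeros f | x ∈ l} ≤ 2 := by
      intro l hul
      have hul : u ∈ l := by simpa using hul
      rcases Finset.eq_empty_or_nonempty {x ∈ zeros f | x ∈ l} with h0 | ⟨y, hy⟩
      · simp [h0]
      have hy' := mem_filter.1 hy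
      have hyu : u ≠ y := fun e => hu (e ▸ hy'.1)
      refine (h1 l (card_pos.2 ⟨y, ?_⟩)).1.le
      simp only [mem_filter, mem_univ, true_and]
      refine ⟨hy'.1, hy'.2, fun v hv => ?_⟩
      obtain ⟨s, t, rfl⟩ := exists_combination_of_orthogonal l.rep_nonzero
        (proj_mem_iff.1 hul) (proj_mem_iff.1 hy'.2) hv (independent_of_ne hyu)
      rw [eval_dirDeriv_add_smul, mem_zeros.1 (hzero y hy'.1), eval_dirDeriv_self hf,
        mem_zeros.1 hy'.1]
      ring
    have hs := sum_le_sum htwo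
    rw [sum_card_filter_lines, if_neg hu, sum_const, card_lines_through, hord, hK] at hs
    simp only [smul_eq_mul] at hs
    omega
  have h4' := order_eq_four_of_dual_arc (P := ℙ k (Fin 3 → k)) B
    (by rw [h4, hK, hord]) (fun u => ?_)
  · omega
  by_cases hu : u ∈ zeros f
  · left; rw [hBt, h3 u hu]
  have hs := sum_card_filter_lines (L := ℙ k (Fin 3 → k)) (zeros f) u
  rw [if_neg hu, hK] at hs
  -- Bitangents carry two points, other lines none or four, and `3q + 2` is `2` modulo `4`. So the
  -- number of bitangents through `u` is odd, and being at most three it is one or three.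
  have e : ∀ l ∈ ({l | u ∈ l} : Finset (ℙ k (Fin 3 → k))), #{x ∈ zeros f | x ∈ l} =
      2 * (if 0 < #{x | IsTangentAt f x l} then 1 else 0) + 4 * (#{x ∈ zeros f | x ∈ l} / 4) := by
    intro l _
    split_ifs with h
    · rw [(h1 l h).1]
    · rcases h2 l (Nat.eq_zero_of_not_pos h) with h' | h' <;> rw [h']
  rw [sum_congr rfl e, sum_add_distrib, ← mul_sum, ← mul_sum, ← sum_filter, filter_filter,
    ← card_eq_sum_ones, ← hBt] at hs
  have := hfew u hu
  omega

end QuarticBound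

/-! ### Splitting off rational lines and the bound for quintics. -/

noncomputable section LineFactors

open MvPolynomial Configuration Configuration.ofField Configuration.ProjectivePlane Finset
open scoped Classical LinearAlgebra.Projectivization Matrix

set_option linter.unusedSectionVars false

variable {k : Type*} [Field k]

/-- The linear form with coefficients `w`. -/
def linForm (w : Fin 3 → k) : MvPolynomial (Fin 3) k := ∑ i, C (w i) * X i

theorem linForm_isHomogeneous (w : Fin 3 → k) : (linForm w).IsHomogeneous 1 :=
  IsHomogeneous.sum _ _ _ fun _ _ => isHomogeneous_C_mul_X _ _

theorem eval_linForm (w y : Fin 3 → k) : eval y (linForm w) = y ⬝ᵥ w := by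
  simp [linForm, dotProduct, mul_comm]

theorem linForm_ne_zero {w : Fin 3 → k} (hw : w ≠ 0) : linForm w ≠ 0 := by
  intro h
  apply hw
  ext i
  have := congrArg (eval (Pi.single i 1)) h
  rw [eval_linForm] at this
  simpa using this

theorem aeval_sub_aeval_mem {σ R A : Type*} [CommRing R] [CommRing A] [Algebra R A] (I : Ideal A)
    (g h : σ → A) (hgh : ∀ i, g i - h i ∈ I) (f : MvPolynomial σ R) :
    aeval g f - aeval h f ∈ I := by
  rw [← Ideal.Quotient.mk_eq_mk_iff_sub_mem, ← Ideal.Quotient.mkₐ_eq_mk R I, ← AlgHom.comp_apply,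
    ← AlgHom.comp_apply]
  congr 1
  ext i
  simpa using Ideal.Quotient.mk_eq_mk_iff_sub_mem _ _ |>.2 (hgh i)

variable [Fintype k]

/-- Project space linearly onto the plane over `l` along a coordinate axis. The composite of `f`
with the projection vanishes at all vectors, so is zero because `d ≤ q`, and it is congruent to `f`
modulo the equation of `l`. -/
theorem linForm_dvd {f : MvPolynomial (Fin 3) k} {d : ℕ} (hf : f.IsHomogeneous d)
    (hd : d ≤ Fintype.card k) {l : ℙ k (Fin 3 → k)} (hl : ∀ p ∈ l, p ∈ zeros f) :
    linForm l.rep ∣ f := by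
  obtain ⟨j, hj⟩ := Function.ne_iff.1 l.rep_nonzero
  simp only [Pi.zero_apply] at hj
  set σ : Fin 3 → MvPolynomial (Fin 3) k :=
    fun i => X i - if i = j then C (l.rep j)⁻¹ * linForm l.rep else 0 with hσ
  have hσ1 : ∀ i, (σ i).IsHomogeneous 1 := by
    intro i
    refine (isHomogeneous_X k i).sub ?_
    split_ifs
    · exact (linForm_isHomogeneous _).C_mul _
    · exact isHomogeneous_zero _ _ _
  have h0 : aeval σ f = 0 := by
    have hhom : (aeval σ f).IsHomogeneous d := by simpa using hf.aeval σ hσ1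
    refine hhom.eq_zero_of_forall_eval_eq_zero_of_le_card (fun y => ?_) (by simpa using hd)
    set z : Fin 3 → k := fun i => eval y (σ i) with hz
    have e : eval y (aeval σ f) = eval z f := by
      rw [aeval_def, hom_eval₂]
      have : (eval y).comp (algebraMap k (MvPolynomial (Fin 3) k)) = RingHom.id k := by
        ext; simp [algebraMap_eq]
      rw [this]
      rfl
    have hzl : z ⬝ᵥ l.rep = 0 := by
      have : ∀ i, z i * l.rep i = y i * l.rep i -
          if i = j then (y ⬝ᵥ l.rep) else 0 := by
        intro i
        simp only [hz, hσ, map_sub, eval_X]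
        split_ifs with h
        · subst h
          rw [map_mul, eval_C, eval_linForm]
          field_simp
        · simp
      rw [dotProduct, sum_congr rfl fun i _ => this i, sum_sub_distrib, sum_ite_eq' univ j]
      simp [dotProduct]
    rw [e]
    by_cases hz0 : z = 0
    · rw [hz0]
      -- The zero vector gives no point of `l`. A form of positive degree vanishes there; a constant
      -- is evaluated at a point of `l` instead.
      rcases Nat.eq_zero_or_pos d with rfl | hd0
      · have h1 := hl (Projectivization.mk k _ (exists_ne_mem_line l l).choose.rep_nonzero)
          (by rw [Projectivization.mk_rep]; exact (exists_ne_mem_line l l).choose_spec.1)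
        rw [mk_mem_zeros hf] at h1
        have := eval_smul_of_isHomogeneous hf 0 (exists_ne_mem_line l l).choose.rep
        rwa [zero_smul, h1, mul_zero] at this
      · have := eval_smul_of_isHomogeneous hf 0 (0 : Fin 3 → k)
        rwa [zero_smul, zero_pow hd0.ne', zero_mul] at this
    · exact (mk_mem_zeros hf hz0).1 (hl _ ((mk_mem_iff hz0).2 hzl))
  have h1 := aeval_sub_aeval_mem (Ideal.span {linForm l.rep}) X σ (fun i => ?_) f
  · rw [h0, sub_zero, aeval_X_left_apply] at h1
    exact Ideal.mem_span_singleton.1 h1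
  · simp only [hσ, sub_sub_cancel]
    split_ifs
    · exact Ideal.mul_mem_left _ _ (Ideal.mem_span_singleton_self _)
    · exact zero_mem _

/-- The rational points on the lines of a set. -/
def linePoints (S : Finset (ℙ k (Fin 3 → k))) : Finset (ℙ k (Fin 3 → k)) := {p | ∃ l ∈ S, p ∈ l}

/-- Each further line meets an earlier one, so adds at most `q` points. -/
theorem card_linePoints_le (S : Finset (ℙ k (Fin 3 → k))) (hS : S.Nonempty) :
    #(linePoints S) ≤ #S * Fintype.card k + 1 := by
  induction hS using Finset.Nonempty.cons_induction with
  | singleton l =>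
    have := card_points_on (P := ℙ k (Fin 3 → k)) l
    rw [order_projectivePlane] at this
    simp [linePoints, this]
  | cons l S hl hS ih =>
    obtain ⟨m, hm⟩ := hS
    have hlm : l ≠ m := fun h => hl (h ▸ hm)
    obtain ⟨p, ⟨hpl, hpm⟩, -⟩ := HasPoints.existsUnique_point (ℙ k (Fin 3 → k)) _ l m hlm
    have hsub : linePoints (cons l S hl) ⊆
        linePoints S ∪ ({x | x ∈ l} : Finset (ℙ k (Fin 3 → k))).erase p := by
      intro x hx
      simp only [linePoints, mem_filter, mem_univ, true_and, mem_cons, mem_union, mem_erase,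
        exists_eq_or_imp] at hx ⊢
      by_cases hxp : x = p
      · left; exact ⟨m, hm, hxp ▸ hpm⟩
      · exact hx.elim (fun h => Or.inr ⟨hxp, h⟩) Or.inl
    refine (card_le_card hsub).trans ((card_union_le _ _).trans ?_)
    rw [card_erase_of_mem (by simpa using hpl), card_points_on, order_projectivePlane, card_cons]
    have : (#S + 1) * Fintype.card k = #S * Fintype.card k + Fintype.card k := by ring
    omega

/-- No nonzero linear form belongs to the ideal. -/
def NoLinearForm (I : Ideal (MvPolynomial (Fin 3) k)) : Prop :=
  ∀ l ∈ I, l.IsHomogeneous 1 → l = 0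

/-- The prime `I` contains no equation of a line, so cofactors of lines stay in `I`. A line may
split off repeatedly but enters `S` once, whence only an inequality between degrees. -/
theorem exists_containsNoLine_factor {I : Ideal (MvPolynomial (Fin 3) k)} (hI : I.IsPrime)
    (hlin : NoLinearForm I) (d : ℕ) (hd : d ≤ Fintype.card k) {f : MvPolynomial (Fin 3) k}
    (hf : f.IsHomogeneous d) (hfI : f ∈ I) (hf0 : f ≠ 0) :
    ∃ (S : Finset (ℙ k (Fin 3 → k))) (e : ℕ) (g : MvPolynomial (Fin 3) k), g.IsHomogeneous e ∧
      g ∈ I ∧ g ≠ 0 ∧ #S + e ≤ d ∧ zeros f ⊆ linePoints S ∪ zeros g ∧ ContainsNoLine g := by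
  induction d generalizing f with
  | zero =>
    refine ⟨∅, 0, f, hf, hfI, hf0, by simp, subset_union_right, fun l => ?_⟩
    by_contra! hl
    have hdvd := linForm_dvd hf hd hl
    obtain ⟨g, rfl⟩ := hdvd
    obtain ⟨i, hi⟩ := exists_isHomogeneous_of_mul (a := g) (b := linForm l.rep)
      (by rwa [mul_comm]) (by rwa [mul_comm])
    have := ((linForm_isHomogeneous l.rep).mul hi).inj_right hf hf0
    omega
  | succ d ih =>
    by_cases hl : ContainsNoLine f
    · exact ⟨∅, d + 1, f, hf, hfI, hf0, by simp, subset_union_right, hl⟩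
    obtain ⟨l, hl⟩ : ∃ l : ℙ k (Fin 3 → k), ∀ p ∈ l, p ∈ zeros f := by
      simpa [ContainsNoLine] using hl
    obtain ⟨g, rfl⟩ := linForm_dvd hf hd hl
    have hgI : g ∈ I := (hI.mem_or_mem hfI).resolve_left fun h =>
      linForm_ne_zero l.rep_nonzero (hlin _ h (linForm_isHomogeneous _))
    obtain ⟨S, e, h, hh, hhI, hh0, hcard, hsub, hno⟩ := ih (by omega)
      (isHomogeneous_of_mul (by rwa [add_comm]) hf0 (linForm_isHomogeneous _)) hgI
      (right_ne_zero_of_mul hf0)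
    refine ⟨insert l S, e, h, hh, hhI, hh0, ?_, ?_, hno⟩
    · have := card_insert_le l S
      omega
    · intro p hp
      rw [mem_zeros, map_mul, mul_eq_zero, eval_linForm, ← proj_mem_iff] at hp
      rcases hp with hp | hp
      · exact mem_union_left _ (by simpa [linePoints] using Or.inl hp)
      · rcases mem_union.1 (hsub (mem_zeros.2 hp)) with h' | h'
        · refine mem_union_left _ ?_
          simp only [linePoints, mem_filter, mem_univ, true_and, mem_insert,
            exists_eq_or_imp] at h' ⊢
          exact Or.inr h'
        · exact mem_union_right _ h'

theorem two_le_of_mem {I : Ideal (MvPolynomial (Fin 3) k)} (hI : I.IsPrime)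
    (hlin : NoLinearForm I) {d : ℕ} {f : MvPolynomial (Fin 3) k}
    (hf : f.IsHomogeneous d) (hfI : f ∈ I) (hf0 : f ≠ 0) : 2 ≤ d := by
  by_contra! h
  interval_cases d
  · have hc := totalDegree_eq_zero_iff_eq_C.1 ((totalDegree_zero_iff_isHomogeneous _).2 hf)
    rw [hc] at hfI hf0
    refine hI.ne_top (Ideal.eq_top_of_isUnit_mem _ hfI ?_)
    exact (isUnit_iff_ne_zero.2 fun h => hf0 (by rw [h, C_0])).map C
  · exact hf0 (hlin f hfI hf)

/-- All residual degrees give the same bound: `(3q + 1) + (q + 1)` for `e = 2`, `(2q + 1) + (2q +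
1)` for `e = 3`, `(q + 1) + (3q + 1)` for `e = 4`, and `4q + 2` with no lines for `e = 5`. -/
theorem card_zeros_quintic_le {I : Ideal (MvPolynomial (Fin 3) k)} (hI : I.IsPrime)
    (hlin : NoLinearForm I) (hq : 5 ≤ Fintype.card k) {f : MvPolynomial (Fin 3) k}
    (hf : f.IsHomogeneous 5) (hfI : f ∈ I) (hf0 : f ≠ 0) :
    #(zeros f) ≤ 4 * Fintype.card k + 2 := by
  obtain ⟨S, e, g, hg, hgI, hg0, hcard, hsub, hno⟩ :=
    exists_containsNoLine_factor hI hlin 5 hq hf hfI hf0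
  have he := two_le_of_mem hI hlin hg hgI hg0
  have h1 := (card_le_card hsub).trans (card_union_le _ _)
  have h2 := card_zeros_le hg hno (by omega)
  have h3 : #(linePoints S) ≤ #S * Fintype.card k + 1 := by
    rcases S.eq_empty_or_nonempty with rfl | h
    · simp [linePoints]
    · exact card_linePoints_le S h
  have h5 : #(linePoints S) ≤ (5 - e) * Fintype.card k + 1 :=
    h3.trans (by gcongr; omega)
  have he5 : e ≤ 5 := by omega
  interval_cases e
  · omega
  · omega
  -- The general bound `3q + 2` for quartics would be one too large here.
  · have := card_zeros_quartic_le hg hno hq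
    omega
  · have : S = ∅ := by rw [← card_eq_zero]; omega
    subst this
    simp only [linePoints, notMem_empty, false_and, exists_false, filter_false, card_empty] at h1
    omega

end LineFactors

/-! ### Conics through the point and a quintic attaining the bound. -/

noncomputable section Conics

open MvPolynomial Configuration Configuration.ofField Configuration.ProjectivePlane Finset
open scoped Classical LinearAlgebra.Projectivization Matrix

set_option linter.unusedSectionVars false

variable {k : Type*} [Field k] [Fintype k]

theorem containsNoLine_of_mem {I : Ideal (MvPolynomial (Fin 3) k)} (hI : I.IsPrime)
    (hlin : NoLinearForm I) (hq : 2 ≤ Fintype.card k) {g : MvPolynomial (Fin 3) k}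
    (hg : g.IsHomogeneous 2) (hgI : g ∈ I) (hg0 : g ≠ 0) : ContainsNoLine g := by
  intro l
  by_contra! hl
  obtain ⟨h, rfl⟩ := linForm_dvd hg hq hl
  have hh : h.IsHomogeneous 1 := isHomogeneous_of_mul (m := 1) hg hg0 (linForm_isHomogeneous _)
  rcases hI.mem_or_mem hgI with h' | h'
  · exact left_ne_zero_of_mul hg0 (hlin _ h' (linForm_isHomogeneous _))
  · exact right_ne_zero_of_mul hg0 (hlin _ h' hh)

theorem gradAt_eq_zero_of_isTangentAt {f : MvPolynomial (Fin 3) k} {p l l' : ℙ k (Fin 3 → k)}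
    (h : IsTangentAt f p l) (h' : IsTangentAt f p l') (hne : l ≠ l') : gradAt f p = 0 := by
  by_contra h0
  have key : ∀ m, IsTangentAt f p m → m = Projectivization.mk k _ h0 := by
    intro m hm
    have hmem : ∀ x : ℙ k (Fin 3 → k), x ∈ m → x ∈ Projectivization.mk k _ h0 := by
      intro x hx
      have := hm.2.2 x.rep (proj_mem_iff.1 hx)
      rw [eval_rep_dirDeriv] at this
      rw [mem_iff]
      conv_lhs => rw [← x.mk_rep]
      exact (Projectivization.orthogonal_mk _ _).2 this
    obtain ⟨p', hp', hne'⟩ := exists_ne_mem_line p m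
    exact (Nondegenerate.eq_or_eq hm.2.1 hp' (hmem _ hm.2.1) (hmem _ hp')).resolve_left hne'.symm
  exact hne ((key l h).trans (key l' h').symm)

/-- Along a direction `v` of `l` with nonzero derivative, `g(p + tv) = c₁t + g(v)t²` with `c₁ ≠ 0`.
The second zero is `v` itself if `g(v) = 0`, and `t = -c₁/g(v)` otherwise. -/
theorem two_le_card_of_not_isTangentAt {g : MvPolynomial (Fin 3) k} (hg : g.IsHomogeneous 2)
    {p l : ℙ k (Fin 3 → k)} (hp : p ∈ zeros g) (hpl : p ∈ l) (hT : ¬ IsTangentAt g p l) :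
    2 ≤ #{x ∈ zeros g | x ∈ l} := by
  obtain ⟨v, hv, hD⟩ : ∃ v : Fin 3 → k, v ⬝ᵥ l.rep = 0 ∧ eval p.rep (dirDeriv g v) ≠ 0 := by
    by_contra! h
    exact hT ⟨hp, hpl, h⟩
  have hvp : ∀ c : k, v ≠ c • p.rep := by
    rintro c rfl
    have := eval_dirDeriv_add_smul g p.rep p.rep p.rep c 0
    rw [zero_smul, add_zero, zero_mul, add_zero, eval_dirDeriv_self hg, mem_zeros.1 hp] at this
    exact hD (by rw [this]; ring)
  suffices h : ∃ s t : k, t ≠ 0 ∧ eval (s • p.rep + t • v) g = 0 by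
    obtain ⟨s, t, ht, he⟩ := h
    have hnp : ∀ c : k, s • p.rep + t • v ≠ c • p.rep := by
      intro c hc
      refine hvp (t⁻¹ * (c - s)) ?_
      rw [mul_smul, sub_smul, ← hc, add_sub_cancel_left, smul_smul, inv_mul_cancel₀ ht, one_smul]
    have hne : s • p.rep + t • v ≠ 0 := by simpa using hnp 0
    refine one_lt_card.2 ⟨p, mem_filter.2 ⟨hp, hpl⟩, Projectivization.mk k _ hne,
      mem_filter.2 ⟨(mk_mem_zeros hg hne).2 he, (mk_mem_iff hne).2 ?_⟩, fun h => ?_⟩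
    · rw [add_dotProduct, smul_dotProduct, smul_dotProduct, hv, proj_mem_iff.1 hpl]
      simp
    · obtain ⟨c, hc⟩ := (Projectivization.mk_eq_mk_iff' _ _ _ _ _).1 (p.mk_rep.trans h).symm
      exact hnp c hc.symm
  obtain ⟨hdeg, hcoeff⟩ := lineRestrict_degree hg p.rep v
  by_cases h0 : eval v g = 0
  · exact ⟨0, 1, one_ne_zero, by simpa using h0⟩
  have e : ∀ t : k, eval (p.rep + t • v) g =
      (lineRestrict g p.rep v).coeff 0 + (lineRestrict g p.rep v).coeff 1 * t + eval v g * t ^ 2 := by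
    intro t
    rw [← eval_lineRestrict, Polynomial.eval_eq_sum_range' (n := 3) (by omega), ← hcoeff]
    simp [sum_range_succ]
  have c0 : (lineRestrict g p.rep v).coeff 0 = 0 := by
    have := e 0
    rw [zero_smul, add_zero, mem_zeros.1 hp] at this
    linear_combination -this
  have c1 : (lineRestrict g p.rep v).coeff 1 ≠ 0 := by
    have := eval_derivative_lineRestrict g p.rep v 0
    rw [zero_smul, add_zero, ← Polynomial.coeff_zero_eq_eval_zero, Polynomial.coeff_derivative]
      at this
    intro h
    apply hD
    rw [← this]
    simp [h]
  refine ⟨1, -(lineRestrict g p.rep v).coeff 1 / eval v g, div_ne_zero (neg_ne_zero.2 c1) h0, ?_⟩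
  rw [one_smul, e, c0]
  field_simp
  ring

/-- The point `p` is nonsingular, since otherwise the line `pp'` would be tangent at `p` and contain
`p'`, which is too much for degree two. So every line through `p` but one has a second zero, giving
`q` further points. -/
theorem card_zeros_conic {g : MvPolynomial (Fin 3) k} (hg : g.IsHomogeneous 2)
    (hl : ContainsNoLine g) {p p' : ℙ k (Fin 3 → k)} (hp : p ∈ zeros g) (hp' : p' ∈ zeros g)
    (hne : p ≠ p') : #(zeros g) = Fintype.card k + 1 := by
  refine le_antisymm ?_ ?_
  · have := card_zeros_le hg hl (by norm_num)
    omega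
  have hT := tangentSystem hg hl
  have hgrad : gradAt g p ≠ 0 := by
    intro h0
    obtain ⟨m, hm, -⟩ := HasLines.existsUnique_line (ℙ k (Fin 3 → k)) (ℙ k (Fin 3 → k)) p p' hne
    have h1 : 0 < #{x | IsTangentAt g x m} := card_pos.2 ⟨p, by
      simpa using ⟨hp, hm.1, fun v _ => by rw [eval_rep_dirDeriv, h0, dotProduct_zero]⟩⟩
    have h2 : 1 < #{x ∈ zeros g | x ∈ m} := one_lt_card.2
      ⟨p, mem_filter.2 ⟨hp, hm.1⟩, p', mem_filter.2 ⟨hp', hm.2⟩, hne⟩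
    have := hT.card_add_card_le m
    omega
  have hs := sum_card_filter_lines (L := ℙ k (Fin 3 → k)) (zeros g) p
  rw [if_pos hp, order_projectivePlane] at hs
  obtain ⟨l, hlT⟩ := exists_isTangentAt hg hp
  have hlow : ∀ m ∈ ({m | p ∈ m} : Finset (ℙ k (Fin 3 → k))),
      2 ≤ #{x ∈ zeros g | x ∈ m} + if l = m then 1 else 0 := by
    intro m hm
    have hm : p ∈ m := by simpa using hm
    split_ifs with h
    · have : 0 < #{x ∈ zeros g | x ∈ m} := card_pos.2 ⟨p, mem_filter.2 ⟨hp, hm⟩⟩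
      omega
    · exact two_le_card_of_not_isTangentAt hg hp hm fun hmT =>
        hgrad (gradAt_eq_zero_of_isTangentAt hlT hmT h)
  have := sum_le_sum hlow
  rw [sum_add_distrib, hs, sum_const, card_lines_through, order_projectivePlane, sum_ite_eq,
    if_pos (by simpa using hlT.2.1)] at this
  simp only [smul_eq_mul] at this
  omega

theorem card_three_concurrent {u l₁ l₂ l₃ : ℙ k (Fin 3 → k)} (h₁ : u ∈ l₁) (h₂ : u ∈ l₂)
    (h₃ : u ∈ l₃) (h12 : l₁ ≠ l₂) (h13 : l₁ ≠ l₃) (h23 : l₂ ≠ l₃) :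
    #{x : ℙ k (Fin 3 → k) | x ∈ l₁ ∨ x ∈ l₂ ∨ x ∈ l₃} = 3 * Fintype.card k + 1 := by
  have hc : ∀ l : ℙ k (Fin 3 → k), u ∈ l →
      #(({x | x ∈ l} : Finset (ℙ k (Fin 3 → k))).erase u) = Fintype.card k := by
    intro l hl
    rw [card_erase_of_mem (by simpa using hl), card_points_on, order_projectivePlane]
    rfl
  have hd : ∀ l l' : ℙ k (Fin 3 → k), u ∈ l → u ∈ l' → l ≠ l' →
      ∀ x ∈ ({x | x ∈ l} : Finset (ℙ k (Fin 3 → k))).erase u,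
        x ∉ ({x | x ∈ l'} : Finset (ℙ k (Fin 3 → k))).erase u := by
    intro l l' hl hl' hne x hx hx'
    simp only [mem_erase, mem_filter, mem_univ, true_and] at hx hx'
    exact hne ((Nondegenerate.eq_or_eq hx.2 hl hx'.2 hl').resolve_left hx.1)
  have e : ({x | x ∈ l₁ ∨ x ∈ l₂ ∨ x ∈ l₃} : Finset (ℙ k (Fin 3 → k))) =
      insert u ((({x | x ∈ l₁} : Finset (ℙ k (Fin 3 → k))).erase u ∪
        ({x | x ∈ l₂} : Finset (ℙ k (Fin 3 → k))).erase u) ∪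
        ({x | x ∈ l₃} : Finset (ℙ k (Fin 3 → k))).erase u) := by
    ext x
    by_cases hx : x = u
    · subst hx; simp [h₁]
    · simp [hx]
  rw [e, card_insert_of_notMem (by simp), card_union_of_disjoint, card_union_of_disjoint,
    hc _ h₁, hc _ h₂, hc _ h₃]
  · ring
  · exact disjoint_left.2 (hd _ _ h₁ h₂ h12)
  · rw [disjoint_union_left]
    exact ⟨disjoint_left.2 (hd _ _ h₁ h₃ h13), disjoint_left.2 (hd _ _ h₂ h₃ h23)⟩

/-- The product of `g` with three concurrent lines external to its `q + 1` points has `(3q + 1) + (q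
+ 1)` zeros. -/
theorem exists_quintic_card_zeros {I : Ideal (MvPolynomial (Fin 3) k)} (hI : I.IsPrime)
    (hlin : NoLinearForm I) (hq : 5 ≤ Fintype.card k) {g : MvPolynomial (Fin 3) k}
    (hg : g.IsHomogeneous 2) (hgI : g ∈ I) (hg0 : g ≠ 0) {p p' : ℙ k (Fin 3 → k)}
    (hp : p ∈ zeros g) (hp' : p' ∈ zeros g) (hne : p ≠ p') :
    ∃ f ∈ I, f.IsHomogeneous 5 ∧ #(zeros f) = 4 * Fintype.card k + 2 := by
  have hl := containsNoLine_of_mem hI hlin (by omega) hg hgI hg0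
  have hT := tangentSystem hg hl
  have hcard := card_zeros_conic hg hl hp hp' hne
  obtain ⟨u, hu⟩ := exists_three_external_lines (L := ℙ k (Fin 3 → k))
    (by rwa [order_projectivePlane]) (zeros g) (by rwa [order_projectivePlane])
    (fun l => (Nat.le_add_right _ _).trans (hT.card_add_card_le l))
  obtain ⟨l₁, h₁, l₂, h₂, l₃, h₃, h12, h13, h23⟩ := two_lt_card.1 hu
  simp only [mem_filter, mem_univ, true_and, card_eq_zero, filter_eq_empty_iff] at h₁ h₂ h₃
  refine ⟨linForm l₁.rep * linForm l₂.rep * linForm l₃.rep * g, I.mul_mem_left _ hgI,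
    (((linForm_isHomogeneous _).mul (linForm_isHomogeneous _)).mul (linForm_isHomogeneous _)).mul
      hg, ?_⟩
  have e : zeros (linForm l₁.rep * linForm l₂.rep * linForm l₃.rep * g) =
      ({x | x ∈ l₁ ∨ x ∈ l₂ ∨ x ∈ l₃} : Finset (ℙ k (Fin 3 → k))) ∪ zeros g := by
    ext x
    simp only [mem_zeros, map_mul, mul_eq_zero, eval_linForm, ← proj_mem_iff, mem_union,
      mem_filter, mem_univ, true_and, or_assoc]
  rw [e, card_union_of_disjoint, card_three_concurrent h₁.1 h₂.1 h₃.1 h12 h13 h23, hcard]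
  · ring
  · rw [disjoint_right]
    intro x hx
    simp only [mem_filter, mem_univ, true_and, not_or]
    exact ⟨h₁.2 hx, h₂.2 hx, h₃.2 hx⟩

end Conics

/-! ### Residue fields, forms through a point, and existence of `P`. -/

noncomputable section ResidueFields

namespace BlowupCode

open MvPolynomial

attribute [local instance] MvPolynomial.gradedAlgebra

variable {k : Type*} [Field k]

theorem algebraMap_amb_injective :
    Function.Injective (algebraMap (MvPolynomial (Fin 3) k) (Amb k)) :=
  IsFractionRing.injective _ _

theorem algebraMap_ne_zero_of_notMem {x : PlanePoint k} {b : MvPolynomial (Fin 3) k}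
    (hb : b ∉ x.asHomogeneousIdeal) : algebraMap _ (Amb k) b ≠ 0 := by
  intro h
  rw [map_eq_zero_iff _ algebraMap_amb_injective] at h
  exact hb (h ▸ zero_mem _)

theorem exists_X_notMem (x : PlanePoint k) : ∃ i, (X i : MvPolynomial (Fin 3) k) ∉
    x.asHomogeneousIdeal := by
  by_contra! h
  refine x.not_irrelevant_le fun f hf => ?_
  have hf0 : homogeneousComponent 0 f = 0 := by
    have := (HomogeneousIdeal.mem_irrelevant_iff _ _).1 hf
    rw [← decomposition.decompose'_apply]
    exact this
  have h1 : f ∈ Ideal.span (X '' (Set.univ : Set (Fin 3)) : Set (MvPolynomial (Fin 3) k)) := by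
    rw [mem_ideal_span_X_image]
    intro m hm
    by_contra! hc
    have hm0 : m = 0 := by ext i; simpa using hc i
    rw [homogeneousComponent_zero, C_eq_zero] at hf0
    subst hm0
    exact mem_support_iff.1 hm hf0
  have h2 : Ideal.span (X '' (Set.univ : Set (Fin 3)) : Set (MvPolynomial (Fin 3) k)) ≤
      x.asHomogeneousIdeal.toIdeal := by
    rw [Ideal.span_le]
    rintro _ ⟨i, -, rfl⟩
    exact h i
  exact h2 h1

theorem X_mem_irrelevant (i : Fin 3) : (X i : MvPolynomial (Fin 3) k) ∈
    HomogeneousIdeal.irrelevant (homogeneousSubmodule (Fin 3) k) := by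
  rw [HomogeneousIdeal.mem_irrelevant_iff]
  have : homogeneousComponent 0 (X i : MvPolynomial (Fin 3) k) = 0 := by
    simp [homogeneousComponent_zero]
  rw [← this, ← decomposition.decompose'_apply]
  rfl

theorem pow_notMem {x : PlanePoint k} {a : MvPolynomial (Fin 3) k}
    (ha : a ∉ x.asHomogeneousIdeal) (n : ℕ) : a ^ n ∉ x.asHomogeneousIdeal :=
  fun h => ha (x.isPrime.mem_of_pow_mem n h)

theorem mul_notMem {x : PlanePoint k} {a b : MvPolynomial (Fin 3) k}
    (ha : a ∉ x.asHomogeneousIdeal) (hb : b ∉ x.asHomogeneousIdeal) :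
    a * b ∉ x.asHomogeneousIdeal :=
  fun h => (x.isPrime.mem_or_mem h).elim ha hb

theorem div_mem_localRing {x : PlanePoint k} {n : ℕ} {a b : MvPolynomial (Fin 3) k}
    (ha : a.IsHomogeneous n) (hb : b.IsHomogeneous n) (hbx : b ∉ x.asHomogeneousIdeal) :
    algebraMap _ (Amb k) a / algebraMap _ (Amb k) b ∈ localRing x :=
  ⟨n, a, ha, b, hb, hbx, rfl⟩

/-- A fraction with denominator not vanishing at `x` is invertible in the local ring if and only
if its numerator does not vanish at `x`. -/
theorem inv_div_mem_localRing_iff {x : PlanePoint k} {n : ℕ} {a b : MvPolynomial (Fin 3) k}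
    (ha : a.IsHomogeneous n) (hb : b.IsHomogeneous n) (hbx : b ∉ x.asHomogeneousIdeal)
    (ha0 : a ≠ 0) :
    (algebraMap _ (Amb k) a / algebraMap _ (Amb k) b)⁻¹ ∈ localRing x ↔
      a ∉ x.asHomogeneousIdeal := by
  rw [inv_div]
  constructor
  · rintro ⟨m, c, hc, d, hd, hdx, e⟩ hax
    have ha' : algebraMap _ (Amb k) a ≠ 0 := by
      rwa [Ne, map_eq_zero_iff _ algebraMap_amb_injective]
    rw [div_eq_div_iff ha' (algebraMap_ne_zero_of_notMem hdx), ← map_mul, ← map_mul] at e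
    refine mul_notMem hbx hdx ?_
    rw [algebraMap_amb_injective e]
    exact Ideal.mul_mem_left _ _ hax
  · exact fun hax => div_mem_localRing hb ha hax

theorem mem_maximalIdeal_subalgebra_iff {B : Subalgebra k (Amb k)} [IsLocalRing B] (f : B) :
    f ∈ IsLocalRing.maximalIdeal B ↔ (f : Amb k) = 0 ∨ (f : Amb k)⁻¹ ∉ B := by
  rw [IsLocalRing.mem_maximalIdeal, mem_nonunits_iff, ← not_iff_not]
  push Not
  constructor
  · rintro ⟨u, rfl⟩
    have h0 : ((u : B) : Amb k) * ((↑u⁻¹ : B) : Amb k) = 1 := congrArg Subtype.val u.mul_inv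
    refine ⟨left_ne_zero_of_mul_eq_one h0, ?_⟩
    rw [← eq_inv_of_mul_eq_one_right h0]
    exact (↑u⁻¹ : B).2
  · rintro ⟨h0, h⟩
    exact IsUnit.of_mul_eq_one ⟨_, h⟩ (Subtype.ext (mul_inv_cancel₀ h0))

theorem div_mem_maximalIdeal_iff {x : PlanePoint k} {n : ℕ} {a b : MvPolynomial (Fin 3) k}
    (ha : a.IsHomogeneous n) (hb : b.IsHomogeneous n) (hbx : b ∉ x.asHomogeneousIdeal) :
    (⟨_, div_mem_localRing ha hb hbx⟩ : localRing x) ∈ IsLocalRing.maximalIdeal (localRing x) ↔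
      a ∈ x.asHomogeneousIdeal := by
  rw [mem_maximalIdeal_subalgebra_iff]
  by_cases h0 : a = 0
  · subst h0
    simp
  · rw [inv_div_mem_localRing_iff ha hb hbx h0, not_not, or_iff_right]
    exact div_ne_zero (by rwa [Ne, map_eq_zero_iff _ algebraMap_amb_injective])
      (algebraMap_ne_zero_of_notMem hbx)

/-- The germ at `x` of `f / X i ^ m`, for forms `f` of degree `m`. -/
def formGerm (x : PlanePoint k) {i : Fin 3} (hi : (X i : MvPolynomial (Fin 3) k) ∉
    x.asHomogeneousIdeal) (m : ℕ) : homogeneousSubmodule (Fin 3) k m →ₗ[k] localRing x where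
  toFun f := ⟨_, div_mem_localRing f.2 (isHomogeneous_X_pow i m) (pow_notMem hi m)⟩
  map_add' f g := by
    ext
    simp [add_div]
  map_smul' c f := by
    ext
    change algebraMap _ (Amb k) (c • (f : MvPolynomial (Fin 3) k)) / _ = c • (_ / _)
    rw [Algebra.smul_def c, map_mul, ← IsScalarTower.algebraMap_apply, mul_div_assoc,
      ← Algebra.smul_def]

/-- The value at `x` of `f / X i ^ m`, for forms `f` of degree `m`. -/
def formValue (x : PlanePoint k) {i : Fin 3} (hi : (X i : MvPolynomial (Fin 3) k) ∉
    x.asHomogeneousIdeal) (m : ℕ) :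
    homogeneousSubmodule (Fin 3) k m →ₗ[k] IsLocalRing.ResidueField (localRing x) :=
  (IsScalarTower.toAlgHom k (localRing x) (IsLocalRing.ResidueField (localRing x))).toLinearMap ∘ₗ
    formGerm x hi m

variable {x : PlanePoint k} {i : Fin 3}

theorem formValue_apply (hi : (X i : MvPolynomial (Fin 3) k) ∉ x.asHomogeneousIdeal) {m : ℕ}
    (f : homogeneousSubmodule (Fin 3) k m) :
    formValue x hi m f = IsLocalRing.residue (localRing x) (formGerm x hi m f) :=
  rfl

theorem formValue_eq_zero_iff (hi : (X i : MvPolynomial (Fin 3) k) ∉ x.asHomogeneousIdeal) {m : ℕ}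
    (f : homogeneousSubmodule (Fin 3) k m) :
    formValue x hi m f = 0 ↔ (f : MvPolynomial (Fin 3) k) ∈ x.asHomogeneousIdeal := by
  rw [formValue_apply, IsLocalRing.residue_eq_zero_iff]
  exact div_mem_maximalIdeal_iff f.2 (isHomogeneous_X_pow i m) (pow_notMem hi m)

theorem finrank_homogeneousSubmodule (m : ℕ) :
    Module.finrank k (homogeneousSubmodule (Fin 3) k m) = (m + 2).choose m := by
  have e := Finset.card_finsuppAntidiag_nat_eq_choose (s := (Finset.univ : Finset (Fin 3))) m
  have h : {d : Fin 3 →₀ ℕ | d.degree = m} =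
      ((Finset.univ : Finset (Fin 3)).finsuppAntidiag m : Set (Fin 3 →₀ ℕ)) := by
    ext d
    simp [Finset.mem_finsuppAntidiag, Finsupp.degree_eq_sum]
  have h2 := (AddMonoidAlgebra.supportedEquivFinsupp (R := k) (S := k)
    {d : Fin 3 →₀ ℕ | d.degree = m}).finrank_eq
  rw [homogeneousSubmodule_eq_finsupp_supported]
  refine h2.trans ?_
  rw [h, Module.finrank_finsupp_self]
  refine ((Fintype.card_coe _).trans e).trans ?_
  simp [add_comm]

instance (m : ℕ) : Module.Finite k (homogeneousSubmodule (Fin 3) k m) :=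
  Module.Finite.iff_fg.2 (homogeneousSubmodule_fg (σ := Fin 3) (R := k) m)

/-- The forms of degree `m` vanishing at the point `P`. -/
def formsThrough (P : PlanePoint k) (m : ℕ) : Submodule k (MvPolynomial (Fin 3) k) :=
  homogeneousSubmodule (Fin 3) k m ⊓ P.asHomogeneousIdeal.toIdeal.restrictScalars k

theorem mem_formsThrough {P : PlanePoint k} {m : ℕ} {f : MvPolynomial (Fin 3) k} :
    f ∈ formsThrough P m ↔ f.IsHomogeneous m ∧ f ∈ P.asHomogeneousIdeal :=
  Iff.rfl

theorem formsThrough_eq_map (hi : (X i : MvPolynomial (Fin 3) k) ∉ x.asHomogeneousIdeal) (m : ℕ) :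
    formsThrough x m = (LinearMap.ker (formValue x hi m)).map
      (homogeneousSubmodule (Fin 3) k m).subtype := by
  ext f
  simp only [mem_formsThrough, Submodule.mem_map, LinearMap.mem_ker, formValue_eq_zero_iff]
  constructor
  · exact fun h => ⟨⟨f, h.1⟩, h.2, rfl⟩
  · rintro ⟨g, hg, rfl⟩
    exact ⟨g.2, hg⟩

theorem noLinearForm_of_not_liesOnRationalLine {P : PlanePoint k} (hP : ¬ LiesOnRationalLine P) :
    NoLinearForm P.asHomogeneousIdeal.toIdeal := by
  intro l hl h1
  by_contra h0
  exact hP ⟨l, h1, h0, hl⟩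

/-- For a point of degree `3` on no rational line, the values of linear forms exhaust the residue
field. -/
theorem formValue_surjective {P : PlanePoint k} (hd : Module.finrank k
    (IsLocalRing.ResidueField (localRing P)) = 3) (hP : NoLinearForm P.asHomogeneousIdeal.toIdeal)
    (hi : (X i : MvPolynomial (Fin 3) k) ∉ P.asHomogeneousIdeal) (m : ℕ) :
    Function.Surjective (formValue P hi (m + 1)) := by
  have hfin : Module.Finite k (IsLocalRing.ResidueField (localRing P)) :=
    Module.finite_of_finrank_pos (by omega)
  have h1 : Function.Injective (formValue P hi 1) := by
    rw [injective_iff_map_eq_zero]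
    intro f hf
    rw [formValue_eq_zero_iff] at hf
    exact Subtype.ext (hP f hf f.2)
  -- The space of linear forms and the residue field both have dimension `3`.
  have h1' : Function.Surjective (formValue P hi 1) := by
    refine (LinearMap.injective_iff_surjective_of_finrank_eq_finrank ?_).1 h1
    rw [hd, finrank_homogeneousSubmodule]
    rfl
  intro y
  obtain ⟨l, hl⟩ := h1' y
  refine ⟨⟨X i ^ m * (l : MvPolynomial (Fin 3) k), (isHomogeneous_X_pow i m).mul l.2⟩, ?_⟩
  rw [← hl, formValue_apply, formValue_apply]
  congr 1
  ext
  have h0 := algebraMap_ne_zero_of_notMem hi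
  simp only [formGerm, LinearMap.coe_mk, AddHom.coe_mk, map_mul, map_pow, pow_one]
  rw [pow_succ, mul_div_mul_left _ _ (pow_ne_zero _ h0)]

/-- The point imposes three independent conditions in every positive degree. -/
theorem finrank_formsThrough {P : PlanePoint k} (hd : Module.finrank k
    (IsLocalRing.ResidueField (localRing P)) = 3) (hP : NoLinearForm P.asHomogeneousIdeal.toIdeal)
    (m : ℕ) : Module.finrank k (formsThrough P (m + 1)) + 3 = (m + 3).choose (m + 1) := by
  obtain ⟨i, hi⟩ := exists_X_notMem P
  rw [formsThrough_eq_map hi, Submodule.finrank_map_subtype_eq,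
    ← finrank_homogeneousSubmodule (k := k)]
  have := LinearMap.finrank_range_add_finrank_ker (formValue P hi (m + 1))
  rw [LinearMap.range_eq_top.2 (formValue_surjective hd hP hi m), finrank_top, hd] at this
  omega

/-- If `x` is the ideal of a point with homogeneous coordinates `c` in `K`, the values of whose
forms of some degree exhaust `K`, the degree of `x` is the degree of `K`. -/
theorem finrank_residueField_eq {K : Type*} [Field K] [Algebra k K] (c : Fin 3 → K)
    (hx : ∀ (n : ℕ) (f : MvPolynomial (Fin 3) k), f.IsHomogeneous n →
      (f ∈ x.asHomogeneousIdeal ↔ aeval c f = 0)) (m : ℕ)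
    (hs : ∀ y : K, ∃ f : MvPolynomial (Fin 3) k, f.IsHomogeneous m ∧ aeval c f = y) :
    Module.finrank k (IsLocalRing.ResidueField (localRing x)) = Module.finrank k K := by
  obtain ⟨i, hi⟩ := exists_X_notMem x
  have hsurj : Function.Surjective (formValue x hi m) := by
    intro y
    obtain ⟨⟨_, n, a, ha, b, hb, hbx, rfl⟩, rfl⟩ := IsLocalRing.residue_surjective y
    have hb0 : aeval c b ≠ 0 := fun h => hbx ((hx _ b hb).2 h)
    obtain ⟨f, hf, hfc⟩ := hs (aeval c a * aeval c (X i ^ m : MvPolynomial (Fin 3) k) / aeval c b)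
    refine ⟨⟨f, hf⟩, ?_⟩
    rw [formValue_apply, ← sub_eq_zero, ← map_sub, IsLocalRing.residue_eq_zero_iff]
    have hm : f * b - a * X i ^ m ∈ x.asHomogeneousIdeal := by
      have hom : (f * b - a * X i ^ m).IsHomogeneous (m + n) := by
        refine (hf.mul hb).sub ?_
        rw [add_comm]
        exact IsHomogeneous.mul ha (isHomogeneous_X_pow i m)
      rw [hx _ _ hom, map_sub, map_mul, map_mul, hfc, div_mul_cancel₀ _ hb0, sub_self]
    have hom : (f * b - a * X i ^ m).IsHomogeneous (m + n) := by
      refine (hf.mul hb).sub ?_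
      rw [add_comm]
      exact IsHomogeneous.mul ha (isHomogeneous_X_pow i m)
    have key := (div_mem_maximalIdeal_iff hom ((isHomogeneous_X_pow i m).mul hb)
      (mul_notMem (pow_notMem hi m) hbx)).2 hm
    convert key using 1
    ext
    have h1 := algebraMap_ne_zero_of_notMem (pow_notMem hi m)
    have h2 := algebraMap_ne_zero_of_notMem hbx
    simp only [formGerm, LinearMap.coe_mk, AddHom.coe_mk, AddSubgroupClass.coe_sub, map_sub,
      map_mul]
    rw [div_sub_div _ _ h1 h2]
    ring
  have hsurj' : Function.Surjective ((aeval c : MvPolynomial (Fin 3) k →ₐ[k] K).toLinearMap ∘ₗ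
      (homogeneousSubmodule (Fin 3) k m).subtype) := by
    intro y
    obtain ⟨f, hf, hfc⟩ := hs y
    exact ⟨⟨f, hf⟩, hfc⟩
  -- Both fields are quotients of the forms of degree `m` by the forms vanishing at the point.
  have hker : LinearMap.ker (formValue x hi m) =
      LinearMap.ker ((aeval c : MvPolynomial (Fin 3) k →ₐ[k] K).toLinearMap ∘ₗ
      (homogeneousSubmodule (Fin 3) k m).subtype) := by
    ext f
    rw [LinearMap.mem_ker, LinearMap.mem_ker, formValue_eq_zero_iff, hx _ _ f.2]
    rfl
  rw [← ((formValue x hi m).quotKerEquivOfSurjective hsurj).finrank_eq, hker,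
    (LinearMap.quotKerEquivOfSurjective _ hsurj').finrank_eq]

/-- The point of the projective plane over `k` with homogeneous coordinates `c` in an extension of
`k`. -/
def pointOf {K : Type*} [Field K] [Algebra k K] (c : Fin 3 → K) (hc : c ≠ 0) : PlanePoint k where
  -- The extra variable records the degree and makes the kernel homogeneous, which fails for plain
  -- evaluation at `c`.
  asHomogeneousIdeal := ⟨RingHom.ker (scaleHom c : MvPolynomial (Fin 3) k →ₐ[k] Polynomial K), by
    intro n f hf
    have e : ((DirectSum.decompose (homogeneousSubmodule (Fin 3) k) f n : homogeneousSubmodule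
        (Fin 3) k n) : MvPolynomial (Fin 3) k) = homogeneousComponent n f :=
      decomposition.decompose'_apply f n
    rw [e, RingHom.mem_ker, scaleHom_of_isHomogeneous c (homogeneousComponent_isHomogeneous n f),
      ← coeff_scaleHom, (RingHom.mem_ker).1 hf]
    simp⟩
  isPrime := RingHom.ker_isPrime _
  not_irrelevant_le h := by
    obtain ⟨i, hi⟩ := Function.ne_iff.1 hc
    have h2 : scaleHom c (X i : MvPolynomial (Fin 3) k) = 0 := h (X_mem_irrelevant i)
    rw [scaleHom_of_isHomogeneous c (isHomogeneous_X k i), aeval_X, mul_eq_zero] at h2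
    rcases h2 with h2 | h2
    · exact hi (by simpa using h2)
    · exact pow_ne_zero _ Polynomial.X_ne_zero h2

theorem mem_pointOf_iff {K : Type*} [Field K] [Algebra k K] {c : Fin 3 → K} (hc : c ≠ 0) {n : ℕ}
    {f : MvPolynomial (Fin 3) k} (hf : f.IsHomogeneous n) :
    f ∈ (pointOf (k := k) c hc).asHomogeneousIdeal ↔ aeval c f = 0 := by
  have : f ∈ (pointOf (k := k) c hc).asHomogeneousIdeal ↔ scaleHom c f = 0 := Iff.rfl
  rw [this, scaleHom_of_isHomogeneous c hf, mul_eq_zero,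
    or_iff_left (pow_ne_zero _ Polynomial.X_ne_zero), Polynomial.C_eq_zero]

theorem isClosed_of_le_eq {x : PlanePoint k} (h : ∀ y : PlanePoint k,
    (∀ n, ∀ f : MvPolynomial (Fin 3) k, f.IsHomogeneous n → f ∈ x.asHomogeneousIdeal →
      f ∈ y.asHomogeneousIdeal) → y = x) : IsClosed ({x} : Set (PlanePoint k)) := by
  rw [← closure_eq_iff_isClosed]
  refine Set.Subset.antisymm (fun y hy => ?_) subset_closure
  rw [← ProjectiveSpectrum.le_iff_mem_closure] at hy
  exact h y fun n f _ hf => hy hf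

theorem eq_of_isClosed {x y : PlanePoint k} (hx : IsClosed ({x} : Set (PlanePoint k)))
    (h : ∀ n, ∀ f : MvPolynomial (Fin 3) k, f.IsHomogeneous n → f ∈ x.asHomogeneousIdeal →
      f ∈ y.asHomogeneousIdeal) : y = x := by
  have hle : x ≤ y := by
    intro f hf
    have := (mem_iff_homogeneousComponent_mem x.asHomogeneousIdeal.isHomogeneous f).1 hf
    exact (mem_iff_homogeneousComponent_mem y.asHomogeneousIdeal.isHomogeneous f).2 fun n =>
      h n _ (homogeneousComponent_isHomogeneous n f) (this n)
  rw [ProjectiveSpectrum.le_iff_mem_closure, hx.closure_eq] at hle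
  exact hle

theorem ext_of_isHomogeneous {x y : PlanePoint k}
    (h : ∀ n, ∀ f : MvPolynomial (Fin 3) k, f.IsHomogeneous n →
      (f ∈ x.asHomogeneousIdeal ↔ f ∈ y.asHomogeneousIdeal)) : x = y :=
  ProjectiveSpectrum.ext (HomogeneousIdeal.ext' h)

/-- Let `y` be a specialization and `f` a form in `y` with `f(c) ≠ 0`. With `N = #K - 1`, the form
`f ^ N - X i ^ (nN)` vanishes at `c`, because nonzero elements of `K` have `N`-th power `1`; so it
lies in `y`, and then so does `X i`. -/
theorem isClosed_pointOf {K : Type*} [Field K] [Finite K] [Algebra k K] {c : Fin 3 → K}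
    (hc : c ≠ 0) : IsClosed ({pointOf (k := k) c hc} : Set (PlanePoint k)) := by
  have := Fintype.ofFinite K
  refine isClosed_of_le_eq fun y hy => ext_of_isHomogeneous fun n f hf => ⟨fun hfy => ?_, hy n f hf⟩
  rw [mem_pointOf_iff hc hf]
  by_contra h0
  obtain ⟨i, hi⟩ := exists_X_notMem y
  have hci : c i ≠ 0 := by
    intro h
    exact hi (hy 1 _ (isHomogeneous_X k i) ((mem_pointOf_iff hc (isHomogeneous_X k i)).2
      (by rw [aeval_X, h])))
  have hom : (f ^ (Fintype.card K - 1) - X i ^ (n * (Fintype.card K - 1))).IsHomogeneous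
      (n * (Fintype.card K - 1)) := (hf.pow _).sub (isHomogeneous_X_pow i _)
  have h1 := hy _ _ hom ((mem_pointOf_iff hc hom).2 (by
    rw [map_sub, map_pow, map_pow, aeval_X, mul_comm, pow_mul,
      FiniteField.pow_card_sub_one_eq_one _ h0, FiniteField.pow_card_sub_one_eq_one _ hci,
      one_pow, sub_self]))
  have h2 : f ^ (Fintype.card K - 1) ∈ y.asHomogeneousIdeal.toIdeal :=
    Ideal.pow_mem_of_mem _ hfy _ (Nat.sub_pos_of_lt Fintype.one_lt_card)
  refine pow_notMem hi (n * (Fintype.card K - 1)) ?_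
  have h3 := Ideal.sub_mem _ h2 h1
  rwa [sub_sub_cancel] at h3

/-- Take the point `(1 : θ : θ²)` with `θ` a generator of the cubic extension. Since `1, θ, θ²` is a
basis over `k`, evaluation of linear forms is bijective. -/
theorem exists_point_of_degree_three [Fintype k] : ∃ P : PlanePoint k,
    IsClosedPointOfDegree P 3 ∧ ¬ LiesOnRationalLine P := by
  obtain ⟨p, hp⟩ := CharP.exists k
  obtain ⟨n, hpr, -⟩ := FiniteField.card k p
  have : Fact p.Prime := ⟨hpr⟩
  have hK := FiniteField.finrank_extension k p 3
  set K := FiniteField.Extension k p 3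
  let pb := Field.powerBasisOfFiniteOfSeparable k K
  have hdim : pb.dim = 3 := by rw [← pb.finrank, hK]
  set c : Fin 3 → K := fun i => pb.gen ^ (i : ℕ) with hc
  have hc0 : c ≠ 0 := fun h => by simpa [hc] using congrFun h 0
  have hs : ∀ y : K, ∃ f : MvPolynomial (Fin 3) k, f.IsHomogeneous 1 ∧ aeval c f = y := by
    intro y
    obtain ⟨f, hf, rfl⟩ := pb.exists_eq_aeval y
    rw [hdim] at hf
    refine ⟨linForm fun i => f.coeff i, linForm_isHomogeneous _, ?_⟩
    rw [Polynomial.aeval_eq_sum_range' hf, linForm, map_sum,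
      ← Fin.sum_univ_eq_sum_range (fun i => f.coeff i • pb.gen ^ i)]
    simp [hc, Algebra.smul_def]
  have hx : ∀ (n : ℕ) (f : MvPolynomial (Fin 3) k), f.IsHomogeneous n →
      (f ∈ (pointOf (k := k) c hc0).asHomogeneousIdeal ↔ aeval c f = 0) :=
    fun n f hf => mem_pointOf_iff hc0 hf
  refine ⟨pointOf c hc0, ⟨isClosed_pointOf hc0, ?_⟩, ?_⟩
  · rw [finrank_residueField_eq c hx 1 hs, hK]
  · rintro ⟨l, hl, hl0, hlP⟩
    have hinj : Function.Injective ((aeval c : MvPolynomial (Fin 3) k →ₐ[k] K).toLinearMap ∘ₗ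
        (homogeneousSubmodule (Fin 3) k 1).subtype) := by
      refine (LinearMap.injective_iff_surjective_of_finrank_eq_finrank ?_).2 fun y => ?_
      · rw [finrank_homogeneousSubmodule, hK]
        rfl
      · obtain ⟨f, hf, hfc⟩ := hs y
        exact ⟨⟨f, hf⟩, hfc⟩
    have h1 : (⟨l, hl⟩ : homogeneousSubmodule (Fin 3) k 1) = 0 :=
      hinj (((hx 1 l hl).1 hlP).trans (map_zero _).symm)
    exact hl0 (congrArg Subtype.val h1)

end BlowupCode

end ResidueFields

/-! ### Points of the blow-up and surjectivity of `π`. -/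

noncomputable section BlowupPoints

namespace BlowupCode

open MvPolynomial BlowupPoint

attribute [local instance] MvPolynomial.gradedAlgebra

variable {k : Type*} [Field k]

theorem localRing_le_chart (P x : PlanePoint k) (a : Amb k) : localRing x ≤ chart P x a :=
  fun _ hf => Algebra.subset_adjoin (Or.inl hf)

theorem div_mem_chart {P x : PlanePoint k} {a g : Amb k} (hg : g ∈ idealStalk P x) :
    g / a ∈ chart P x a :=
  Algebra.subset_adjoin (Or.inr ⟨g, hg, rfl⟩)

theorem le_locAt (B : Subalgebra k (Amb k)) (𝔮 : Ideal B) [𝔮.IsPrime] : B ≤ locAt B 𝔮 :=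
  fun b hb => ⟨⟨b, hb⟩, 1, fun h => Ideal.IsPrime.ne_top ‹_› ((Ideal.eq_top_iff_one _).2 h), by simp⟩

theorem idealStalk_le_localRing (P x : PlanePoint k) :
    idealStalk P x ≤ Subalgebra.toSubmodule (localRing x) := by
  refine Submodule.span_le.2 ?_
  rintro _ ⟨n, a, ha, b, hb, -, hbx, rfl⟩
  exact div_mem_localRing ha hb hbx

theorem one_mem_idealStalk {P x : PlanePoint k} (hP : IsClosed ({P} : Set (PlanePoint k)))
    (h : x ≠ P) : (1 : Amb k) ∈ idealStalk P x := by
  obtain ⟨n, a, ha, haP, hax⟩ : ∃ n, ∃ a : MvPolynomial (Fin 3) k, a.IsHomogeneous n ∧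
      a ∈ P.asHomogeneousIdeal ∧ a ∉ x.asHomogeneousIdeal := by
    by_contra! hc
    exact h (eq_of_isClosed hP hc)
  exact Submodule.subset_span ⟨n, a, ha, a, ha, haP, hax,
    (div_self (algebraMap_ne_zero_of_notMem hax)).symm⟩

namespace BlowupPoint

variable {P : PlanePoint k} (z : BlowupPoint P)

theorem localRing_le_ring : localRing z.base ≤ z.ring := by
  obtain ⟨a, -, -, 𝔮, h𝔮, h⟩ := z.exists_chart
  rw [h]
  exact (localRing_le_chart _ _ _).trans (le_locAt _ _)

theorem mem_maxIdeal_iff {f : Amb k} :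
    f ∈ maxIdeal z ↔ f ∈ z.ring ∧ (f = 0 ∨ f⁻¹ ∉ z.ring) := by
  constructor
  · rintro ⟨g, hg, rfl⟩
    exact ⟨g.2, (mem_maximalIdeal_subalgebra_iff g).1 hg⟩
  · rintro ⟨h, h'⟩
    exact ⟨⟨f, h⟩, (mem_maximalIdeal_subalgebra_iff ⟨f, h⟩).2 h', rfl⟩

theorem mul_mem_maxIdeal {f g : Amb k} (hf : f ∈ maxIdeal z) (hg : g ∈ z.ring) :
    g * f ∈ maxIdeal z := by
  obtain ⟨f', hf', rfl⟩ := hf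
  exact ⟨⟨g, hg⟩ * f', Ideal.mul_mem_left _ _ hf', rfl⟩

/-- Away from the exceptional divisor, the blow-up is an isomorphism. -/
theorem ring_eq_localRing (hP : IsClosed ({P} : Set (PlanePoint k))) (h : z.base ≠ P) :
    z.ring = localRing z.base := by
  refine le_antisymm ?_ z.localRing_le_ring
  obtain ⟨a, ha, ha0, 𝔮, h𝔮, hr⟩ := z.exists_chart
  -- The ideal is trivial at the base, so `1 / a` lies in the chart; domination then makes `a` a
  -- unit already downstairs.
  have hinv : a⁻¹ ∈ localRing z.base := by
    refine z.dominates a (idealStalk_le_localRing _ _ ha) ?_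
    rw [hr, ← one_div]
    exact le_locAt _ _ (div_mem_chart (one_mem_idealStalk hP h))
  have hle : chart P z.base a ≤ localRing z.base := by
    refine Algebra.adjoin_le ?_
    rintro f (hf | ⟨g, hg, rfl⟩)
    · exact hf
    · rw [div_eq_mul_inv]
      exact mul_mem (idealStalk_le_localRing _ _ hg) hinv
  intro f hf
  rw [hr] at hf
  obtain ⟨b, c, hc, rfl⟩ := hf
  have hcinv : (c : Amb k)⁻¹ ∈ localRing z.base := by
    refine z.dominates c (hle c.2) ?_
    rw [hr]
    exact ⟨1, c, hc, by simp⟩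
  rw [div_eq_mul_inv]
  exact mul_mem (hle b.2) hcinv

end BlowupPoint

/-- A local ring of the function field which contains a chart of the blow-up over `x` and dominates
the local ring at `x` is centred at a point of the blow-up over `x`. -/
theorem exists_blowupPoint_of_le {P x : PlanePoint k} {a : Amb k} (ha : a ∈ idealStalk P x)
    (ha0 : a ≠ 0) (V : ValuationSubring (Amb k)) (hle : ∀ f ∈ chart P x a, f ∈ V)
    (hdom : ∀ f ∈ localRing x, f⁻¹ ∈ V → f⁻¹ ∈ localRing x) :
    ∃ z : BlowupPoint P, z.base = x := by
  let φ : chart P x a →+* V := (chart P x a).subtype.codRestrict V.toSubring fun f => hle f f.2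
  -- This is the centre of `V` on the chart; elements outside it are units of `V`, so the
  -- localization stays inside `V`.
  let 𝔮 : Ideal (chart P x a) := (IsLocalRing.maximalIdeal V).comap φ
  have h𝔮 : 𝔮.IsPrime := Ideal.comap_isPrime _ _
  have hsub : ∀ f ∈ locAt (chart P x a) 𝔮, f ∈ V := by
    rintro _ ⟨b, c, hc, rfl⟩
    have hu : IsUnit (φ c) := by
      by_contra h
      exact hc ((IsLocalRing.mem_maximalIdeal _).2 h)
    obtain ⟨u, hu⟩ := hu
    have h0 : (c : Amb k) * ((↑u⁻¹ : V) : Amb k) = 1 := by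
      have := congrArg (Subtype.val : V → Amb k) u.mul_inv
      rw [hu] at this
      exact this
    rw [div_eq_mul_inv, ← eq_inv_of_mul_eq_one_right h0]
    exact V.mul_mem _ _ (hle b b.2) (↑u⁻¹ : V).2
  exact ⟨⟨x, locAt (chart P x a) 𝔮, ⟨a, ha, ha0, 𝔮, h𝔮, rfl⟩,
    fun f hf hf' => hdom f hf (hsub _ hf')⟩, rfl⟩

/-- Division of the homogeneous coordinates by `X i`. -/
def dehomogenize (i : Fin 3) : MvPolynomial (Fin 3) k →ₐ[k] Amb k :=
  aeval fun j => (algebraMap (MvPolynomial (Fin 3) k) (Amb k) (X i))⁻¹ *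
    algebraMap (MvPolynomial (Fin 3) k) (Amb k) (X j)

theorem dehomogenize_of_isHomogeneous (i : Fin 3) {n : ℕ} {f : MvPolynomial (Fin 3) k}
    (hf : f.IsHomogeneous n) :
    dehomogenize i f = algebraMap _ (Amb k) f /
      algebraMap (MvPolynomial (Fin 3) k) (Amb k) (X i ^ n) := by
  have h := aeval_smul_of_isHomogeneous hf (algebraMap (MvPolynomial (Fin 3) k) (Amb k) (X i))⁻¹
    (algebraMap (MvPolynomial (Fin 3) k) (Amb k) ∘ X)
  rw [aeval_algebraMap_apply, aeval_X_left_apply] at h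
  rw [map_pow, div_eq_mul_inv, mul_comm, ← inv_pow, ← h]
  rfl

theorem dehomogenize_mem_localRing {x : PlanePoint k} {i : Fin 3}
    (hi : (X i : MvPolynomial (Fin 3) k) ∉ x.asHomogeneousIdeal) (f : MvPolynomial (Fin 3) k) :
    dehomogenize i f ∈ localRing x := by
  rw [← sum_homogeneousComponent f, map_sum]
  refine sum_mem fun n _ => ?_
  rw [dehomogenize_of_isHomogeneous i (homogeneousComponent_isHomogeneous n f)]
  exact div_mem_localRing (homogeneousComponent_isHomogeneous n f) (isHomogeneous_X_pow i n)
    (pow_notMem hi n)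

theorem dehomogenize_mem_idealStalk {P x : PlanePoint k} {i : Fin 3}
    (hi : (X i : MvPolynomial (Fin 3) k) ∉ x.asHomogeneousIdeal) {f : MvPolynomial (Fin 3) k}
    (hf : f ∈ P.asHomogeneousIdeal) : dehomogenize i f ∈ idealStalk P x := by
  rw [← sum_homogeneousComponent f, map_sum]
  refine sum_mem fun n _ => ?_
  have hn := homogeneousComponent_isHomogeneous n f
  rw [dehomogenize_of_isHomogeneous i hn]
  exact Submodule.subset_span ⟨n, _, hn, _, isHomogeneous_X_pow i n,
    homogeneousComponent_mem_of_mem P.asHomogeneousIdeal.isHomogeneous hf n, pow_notMem hi n, rfl⟩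

/-- The valuative argument for properness: choose a valuation ring `V` dominating the local ring at
`x` and a generator of the ideal of `P` least divisible in `V`. The chart for this generator lies in
`V`, and the centre of `V` on it is the point sought. -/
theorem exists_blowupPoint {P : PlanePoint k} (hP0 : ∃ n, ∃ f ∈ formsThrough P n, f ≠ 0)
    (x : PlanePoint k) : ∃ z : BlowupPoint P, z.base = x := by
  obtain ⟨i, hi⟩ := exists_X_notMem x
  obtain ⟨V, hV⟩ := LocalSubring.exists_le_valuationSubring
    { toSubring := (localRing x).toSubring
      isLocalRing := inferInstanceAs (IsLocalRing (localRing x)) }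
  obtain ⟨hsub, hloc⟩ := LocalSubring.le_def.1 hV
  have hsub' : ∀ f ∈ localRing x, f ∈ V := fun f hf => hsub hf
  have hdom : ∀ f ∈ localRing x, f⁻¹ ∈ V → f⁻¹ ∈ localRing x := by
    intro f hf hinv
    by_cases h0 : f = 0
    · rw [h0, inv_zero]
      exact zero_mem _
    have hu : IsUnit (Subring.inclusion hsub ⟨f, hf⟩) :=
      IsUnit.of_mul_eq_one ⟨f⁻¹, hinv⟩ (Subtype.ext (mul_inv_cancel₀ h0))
    have hu' : IsUnit (⟨f, hf⟩ : localRing x) := hloc.map_nonunit _ hu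
    by_contra hc
    exact (mem_maximalIdeal_subalgebra_iff (⟨f, hf⟩ : localRing x)).2 (Or.inr hc) hu'
  obtain ⟨G, hG⟩ := IsNoetherian.noetherian P.asHomogeneousIdeal.toIdeal
  have hGP : ∀ g ∈ G, g ∈ P.asHomogeneousIdeal := fun g hg => by
    have : g ∈ P.asHomogeneousIdeal.toIdeal := hG ▸ Submodule.subset_span hg
    exact this
  obtain ⟨n, f, ⟨hf, hfP⟩, hf0⟩ := hP0
  have hδf : dehomogenize i f ≠ 0 := by
    rw [dehomogenize_of_isHomogeneous i hf]
    exact div_ne_zero (by rwa [Ne, map_eq_zero_iff _ algebraMap_amb_injective])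
      (algebraMap_ne_zero_of_notMem (pow_notMem hi n))
  have hGne : G.Nonempty := by
    by_contra hc
    rw [Finset.not_nonempty_iff_eq_empty] at hc
    subst hc
    have : f ∈ P.asHomogeneousIdeal.toIdeal := hfP
    rw [← hG] at this
    simp at this
    exact hf0 this
  -- The valuation is written multiplicatively, so the largest value belongs to the generator
  -- dividing all others in `V`.
  obtain ⟨g₀, hg₀, hmax⟩ := G.exists_max_image (fun g => V.valuation (dehomogenize i g)) hGne
  have ha0 : dehomogenize i g₀ ≠ 0 := by
    intro h0
    have hker : P.asHomogeneousIdeal.toIdeal ≤ RingHom.ker (dehomogenize (k := k) i) := by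
      rw [← hG]
      refine Submodule.span_le.2 fun g hg => ?_
      have := hmax g hg
      rw [h0, map_zero, le_zero_iff, map_eq_zero] at this
      exact this
    exact hδf (hker hfP)
  have hmem : ∀ f ∈ P.asHomogeneousIdeal, dehomogenize i f / dehomogenize i g₀ ∈ V := by
    intro f hf
    have hfG : f ∈ Submodule.span (MvPolynomial (Fin 3) k) (G : Set (MvPolynomial (Fin 3) k)) := by
      rw [hG]; exact hf
    clear hf
    induction hfG using Submodule.span_induction with
    | mem g hg =>
      rw [← V.valuation_le_one_iff, map_div₀]
      exact div_le_one_of_le₀ (hmax g hg) zero_le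
    | zero => rw [map_zero, zero_div]; exact V.zero_mem
    | add a b _ _ iha ihb => rw [map_add, add_div]; exact V.add_mem _ _ iha ihb
    | smul c a _ iha =>
      rw [smul_eq_mul, map_mul, mul_div_assoc]
      exact V.mul_mem _ _ (hsub' _ (dehomogenize_mem_localRing hi c)) iha
  refine exists_blowupPoint_of_le (dehomogenize_mem_idealStalk hi (hGP g₀ hg₀)) ha0 V ?_ hdom
  have hch : ∀ g ∈ idealStalk P x, g / dehomogenize i g₀ ∈ V := by
    intro g hg
    induction hg using Submodule.span_induction with
    | mem g hg =>
      obtain ⟨m, a, ha, b, hb, haP, hbx, rfl⟩ := hg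
      have e : algebraMap _ (Amb k) a / algebraMap _ (Amb k) b =
          algebraMap (MvPolynomial (Fin 3) k) (Amb k) (X i ^ m) / algebraMap _ (Amb k) b *
            dehomogenize i a := by
        have h1 := algebraMap_ne_zero_of_notMem (pow_notMem hi m)
        have h2 := algebraMap_ne_zero_of_notMem hbx
        rw [dehomogenize_of_isHomogeneous i ha]
        field_simp
      rw [e, mul_div_assoc]
      exact V.mul_mem _ _ (hsub' _ (div_mem_localRing (isHomogeneous_X_pow i m) hb hbx))
        (hmem a haP)
    | zero => rw [zero_div]; exact V.zero_mem
    | add a b _ _ iha ihb => rw [add_div]; exact V.add_mem _ _ iha ihb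
    | smul c a _ iha =>
      rw [Algebra.smul_def, mul_div_assoc]
      exact V.mul_mem _ _ (hsub' _ (Subalgebra.algebraMap_mem _ c)) iha
  intro f hf
  refine Algebra.adjoin_induction ?_ ?_ ?_ ?_ hf
  · rintro f (hf | ⟨g, hg, rfl⟩)
    · exact hsub' f hf
    · exact hch g hg
  · exact fun c => hsub' _ (Subalgebra.algebraMap_mem _ c)
  · exact fun a b _ _ ha hb => V.add_mem _ _ ha hb
  · exact fun a b _ _ ha hb => V.mul_mem _ _ ha hb

end BlowupCode

end BlowupPoints

/-! ### Global sections of `ℒ_m` are the forms of degree `m` through `P`. -/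

noncomputable section GlobalSections

namespace BlowupCode

open MvPolynomial BlowupPoint

attribute [local instance] MvPolynomial.gradedAlgebra

variable {k : Type*} [Field k]

theorem mul_mem_twistStalk {m : ℕ} {x : PlanePoint k} {t r : Amb k} (ht : t ∈ twistStalk m x)
    (hr : r ∈ localRing x) : t * r ∈ twistStalk m x := by
  obtain ⟨n, a, ha, b, hb, hbx, rfl⟩ := ht
  obtain ⟨n', a', ha', b', hb', hbx', rfl⟩ := hr
  refine ⟨n + n', a * a', ?_, b * b', IsHomogeneous.mul hb hb', mul_notMem hbx hbx', ?_⟩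
  · have := IsHomogeneous.mul ha ha'
    rwa [add_zero, add_right_comm] at this
  · rw [div_mul_div_comm, map_mul, map_mul]

theorem form_mem_twistStalk {m : ℕ} (x : PlanePoint k) {f : MvPolynomial (Fin 3) k}
    (hf : f.IsHomogeneous m) : algebraMap _ (Amb k) f ∈ twistStalk m x :=
  ⟨0, f, by rwa [zero_add], 1, isHomogeneous_one _ _,
    fun h => x.isPrime.ne_top ((Ideal.eq_top_iff_one _).2 h), by simp⟩

/-- Multiplication by the inverse of `X i ^ m` trivializes the twisting sheaf. -/
theorem div_X_pow_mem_localRing {m : ℕ} {x : PlanePoint k} {i : Fin 3}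
    (hi : (X i : MvPolynomial (Fin 3) k) ∉ x.asHomogeneousIdeal) {t : Amb k}
    (ht : t ∈ twistStalk m x) :
    t / algebraMap (MvPolynomial (Fin 3) k) (Amb k) (X i ^ m) ∈ localRing x := by
  obtain ⟨n, a, ha, b, hb, hbx, rfl⟩ := ht
  rw [div_div, ← map_mul]
  exact div_mem_localRing ha (IsHomogeneous.mul hb (isHomogeneous_X_pow i m))
    (mul_notMem hbx (pow_notMem hi m))

variable {P : PlanePoint k}

theorem lineStalk_eq_twistStalk (hP : IsClosed ({P} : Set (PlanePoint k))) (m : ℕ)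
    (z : BlowupPoint P) (h : z.base ≠ P) : lineStalk m z = twistStalk m z.base := by
  refine le_antisymm (Submodule.mul_le.2 fun u hu r hr => ?_) fun t ht => ?_
  · rw [z.ring_eq_localRing hP h] at hr
    refine mul_mem_twistStalk ?_ hr
    revert u
    exact Submodule.mul_le.2 fun t ht g hg =>
      mul_mem_twistStalk ht (idealStalk_le_localRing _ _ hg)
  · rw [← mul_one t]
    refine Submodule.mul_mem_mul ?_ (one_mem z.ring)
    rw [← mul_one t]
    exact Submodule.mul_mem_mul ht (one_mem_idealStalk hP h)

theorem idealStalk_self_le_maxIdeal (z : BlowupPoint P) (h : z.base = P) :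
    idealStalk P z.base ≤ maxIdeal z := by
  refine Submodule.span_le.2 ?_
  rintro _ ⟨n, a, ha, b, hb, haP, hbx, rfl⟩
  have hloc := div_mem_localRing ha hb hbx
  refine z.mem_maxIdeal_iff.2 ⟨z.localRing_le_ring hloc, ?_⟩
  by_cases h0 : a = 0
  · left; simp [h0]
  · right
    intro hinv
    refine (inv_div_mem_localRing_iff ha hb hbx h0).1 (z.dominates _ hloc hinv) ?_
    rwa [h]

theorem div_X_pow_mem_maxIdeal {m : ℕ} (z : BlowupPoint P) (h : z.base = P) {i : Fin 3}
    (hi : (X i : MvPolynomial (Fin 3) k) ∉ z.base.asHomogeneousIdeal) {f : Amb k}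
    (hf : f ∈ lineStalk m z) :
    f / algebraMap (MvPolynomial (Fin 3) k) (Amb k) (X i ^ m) ∈ maxIdeal z := by
  refine Submodule.mul_induction_on hf (fun u hu r hr => ?_) fun a b ha hb => ?_
  · refine Submodule.mul_induction_on hu (fun t ht g hg => ?_) fun a b ha hb => ?_
    · have e : t * g * r / algebraMap (MvPolynomial (Fin 3) k) (Amb k) (X i ^ m) =
          (t / algebraMap (MvPolynomial (Fin 3) k) (Amb k) (X i ^ m) * r) * g := by ring
      rw [e]
      exact z.mul_mem_maxIdeal (idealStalk_self_le_maxIdeal z h hg)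
        (mul_mem (z.localRing_le_ring (div_X_pow_mem_localRing hi ht)) hr)
    · rw [add_mul, add_div]
      exact add_mem ha hb
  · rw [add_div]
    exact add_mem ha hb

/-- Over `P` the stalk divided by `X i ^ m` lies in the maximal ideal, whereas a form not vanishing
at `P` becomes a unit. Conversely a form through `P` is `X i ^ m` times an element of the ideal of
`P`. -/
theorem form_mem_lineStalk_iff {m : ℕ} (z : BlowupPoint P) (h : z.base = P)
    {f : MvPolynomial (Fin 3) k} (hf : f.IsHomogeneous m) :
    algebraMap _ (Amb k) f ∈ lineStalk m z ↔ f ∈ P.asHomogeneousIdeal := by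
  obtain ⟨i, hi⟩ := exists_X_notMem z.base
  have hX := algebraMap_ne_zero_of_notMem (pow_notMem hi m)
  constructor
  · intro hfz
    by_contra hfP
    have h0 : f ≠ 0 := fun h0 => hfP (h0 ▸ zero_mem _)
    have h1 := (z.mem_maxIdeal_iff.1 (div_X_pow_mem_maxIdeal z h hi hfz)).2
    rcases h1 with h1 | h1
    · rw [div_eq_zero_iff, or_iff_left hX, map_eq_zero_iff _ algebraMap_amb_injective] at h1
      exact h0 h1
    · refine h1 (z.localRing_le_ring ?_)
      rw [inv_div_mem_localRing_iff hf (isHomogeneous_X_pow i m) (pow_notMem hi m) h0, h]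
      exact hfP
  · intro hfP
    have e : algebraMap _ (Amb k) f = algebraMap (MvPolynomial (Fin 3) k) (Amb k) (X i ^ m) *
        (algebraMap _ (Amb k) f / algebraMap (MvPolynomial (Fin 3) k) (Amb k) (X i ^ m)) * 1 := by
      field_simp
    rw [e]
    exact Submodule.mul_mem_mul (Submodule.mul_mem_mul
      (form_mem_twistStalk _ (isHomogeneous_X_pow i m))
      (Submodule.subset_span ⟨m, f, hf, _, isHomogeneous_X_pow i m, hfP, pow_notMem hi m, rfl⟩))
      (one_mem z.ring)

theorem not_X_dvd_of_irreducible {p : MvPolynomial (Fin 3) k} (hp : Irreducible p) :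
    ¬ (p ∣ X 0 ∧ p ∣ X 1) := by
  rintro ⟨h0, h1⟩
  have hX := (X_prime (R := k) (i := (0 : Fin 3))).irreducible
  have := (hp.dvd_symm hX h0).trans h1
  rw [X_dvd_X] at this
  simp at this

/-- The generic point of the plane curve with equation `p = 0`. -/
def curvePoint (p : MvPolynomial (Fin 3) k) (hp : Irreducible p) : PlanePoint k where
  -- No homogeneity of `p` is assumed, since `p` will be a factor of an arbitrary denominator.
  asHomogeneousIdeal := (Ideal.span {p}).homogeneousCore (homogeneousSubmodule (Fin 3) k)
  isPrime := Ideal.IsPrime.homogeneousCore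
    ((Ideal.span_singleton_prime hp.ne_zero).2 hp.prime)
  not_irrelevant_le h := by
    have hX : ∀ i, p ∣ X i := fun i => Ideal.mem_span_singleton.1
      (Ideal.toIdeal_homogeneousCore_le _ _ (h (X_mem_irrelevant i)))
    exact not_X_dvd_of_irreducible hp ⟨hX 0, hX 1⟩

theorem mem_curvePoint_iff {p : MvPolynomial (Fin 3) k} (hp : Irreducible p) {n : ℕ}
    {f : MvPolynomial (Fin 3) k} (hf : f.IsHomogeneous n) :
    f ∈ (curvePoint p hp).asHomogeneousIdeal ↔ p ∣ f := by
  rw [← Ideal.mem_span_singleton]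
  exact ⟨fun h => Ideal.toIdeal_homogeneousCore_le _ _ h,
    fun h => Ideal.mem_homogeneousCore_of_homogeneous_of_mem ⟨n, hf⟩ h⟩

/-- If all forms through `P` were multiples of `p`, then `p` would divide a nonzero conic through
`P` and itself have degree at least two. The conics through `P` would then be scalar multiples of
`p`, against their dimension `3`. -/
theorem curvePoint_ne [Fintype k] (hlin : NoLinearForm P.asHomogeneousIdeal.toIdeal)
    (hdim : Module.finrank k (formsThrough P 2) = 3) {p : MvPolynomial (Fin 3) k}
    (hp : Irreducible p) : curvePoint p hp ≠ P := by
  intro h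
  have hspan : formsThrough P 2 ≤ k ∙ p := by
    rintro g ⟨hg, hgP⟩
    by_cases h0 : g = 0
    · rw [h0]; exact zero_mem _
    have hdvd : p ∣ g := (mem_curvePoint_iff hp hg).1 (by rw [h]; exact hgP)
    obtain ⟨r, rfl⟩ := hdvd
    obtain ⟨e, he⟩ := exists_isHomogeneous_of_mul hg h0
    have hpP : p ∈ P.asHomogeneousIdeal := by
      rw [← h]; exact (mem_curvePoint_iff hp he).2 dvd_rfl
    have h2 := two_le_of_mem P.isPrime hlin he hpP hp.ne_zero
    obtain ⟨i, hi⟩ := exists_isHomogeneous_of_mul (a := r) (b := p) (by rwa [mul_comm])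
      (by rwa [mul_comm])
    have h3 := (he.mul hi).inj_right hg h0
    obtain rfl : i = 0 := by omega
    rw [totalDegree_eq_zero_iff_eq_C.1 ((totalDegree_zero_iff_isHomogeneous _).2 hi), mul_comm,
      ← smul_eq_C_mul]
    exact Submodule.smul_mem _ _ (Submodule.mem_span_singleton_self p)
  have h1 := Submodule.finrank_mono hspan
  rw [hdim, finrank_span_singleton hp.ne_zero] at h1
  omega

theorem exists_ne_point (hlin : NoLinearForm P.asHomogeneousIdeal.toIdeal) :
    ∃ x : PlanePoint k, x ≠ P := by
  have hc : (Pi.single 0 1 : Fin 3 → k) ≠ 0 := by simp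
  refine ⟨pointOf (Pi.single 0 1 : Fin 3 → k) hc, fun h => ?_⟩
  have h1 : (X 1 : MvPolynomial (Fin 3) k) ∈ P.asHomogeneousIdeal := by
    rw [← h, mem_pointOf_iff hc (isHomogeneous_X k 1)]
    simp
  exact X_ne_zero 1 (hlin _ h1 (isHomogeneous_X k 1))

/-- A rational section of `𝒪(m)` which is regular outside of the point `P` is a form. -/
theorem exists_form_of_forall_mem [Fintype k]
    (hlin : NoLinearForm P.asHomogeneousIdeal.toIdeal)
    (hdim : Module.finrank k (formsThrough P 2) = 3) {m : ℕ} {f : Amb k}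
    (hf : ∀ x ≠ P, f ∈ twistStalk m x) :
    ∃ F : MvPolynomial (Fin 3) k, F.IsHomogeneous m ∧ f = algebraMap _ (Amb k) F := by
  obtain ⟨F, rfl⟩ : ∃ F : MvPolynomial (Fin 3) k, f = algebraMap _ (Amb k) F := by
    obtain ⟨a, b, hab, rfl⟩ := IsFractionRing.exists_reduced_fraction (A := MvPolynomial (Fin 3) k) f
    have hb0 : (b : MvPolynomial (Fin 3) k) ≠ 0 := nonZeroDivisors.coe_ne_zero b
    by_cases hb : IsUnit (b : MvPolynomial (Fin 3) k)
    · obtain ⟨u, hu⟩ := hb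
      refine ⟨a * ↑u⁻¹, ?_⟩
      rw [IsFractionRing.mk'_eq_div, div_eq_iff, ← map_mul, ← hu, mul_assoc, Units.inv_mul, mul_one]
      rwa [Ne, map_eq_zero_iff _ algebraMap_amb_injective]
    · exfalso
      obtain ⟨p, hp, hpb⟩ := WfDvdMonoid.exists_irreducible_factor hb hb0
      -- Regularity at the generic point of `p = 0` gives a denominator prime to `p`, although `p`
      -- divides the denominator of the reduced fraction.
      obtain ⟨n, A, hA, B, hB, hBx, e⟩ := hf _ (curvePoint_ne hlin hdim hp)
      rw [mem_curvePoint_iff hp hB] at hBx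
      have hB0 : B ≠ 0 := fun h => hBx (h ▸ dvd_zero p)
      rw [IsFractionRing.mk'_eq_div, div_eq_div_iff
        (by rwa [Ne, map_eq_zero_iff _ algebraMap_amb_injective])
        (by rwa [Ne, map_eq_zero_iff _ algebraMap_amb_injective]), ← map_mul, ← map_mul] at e
      have h1 : p ∣ a * B := by
        rw [algebraMap_amb_injective e]
        exact hpb.mul_left A
      exact hp.not_isUnit (hab ((hp.prime.dvd_or_dvd h1).resolve_right hBx) hpb)
  refine ⟨F, ?_, rfl⟩
  obtain ⟨x, hx⟩ := exists_ne_point hlin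
  obtain ⟨n, A, hA, B, hB, hBx, e⟩ := hf x hx
  by_cases hF : F = 0
  · rw [hF]; exact isHomogeneous_zero _ _ _
  have hB0 : B ≠ 0 := fun h => hBx (h ▸ zero_mem _)
  rw [eq_div_iff (algebraMap_ne_zero_of_notMem hBx), ← map_mul] at e
  have e' := algebraMap_amb_injective e
  refine isHomogeneous_of_mul (a := B) (m := n) ?_ (mul_ne_zero hB0 hF) hB
  rw [mul_comm, e']
  exact hA

/-- The inclusion of the polynomial ring in its field of fractions. -/
def toAmb : MvPolynomial (Fin 3) k →ₗ[k] Amb k :=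
  (IsScalarTower.toAlgHom k (MvPolynomial (Fin 3) k) (Amb k)).toLinearMap

theorem globalSections_eq [Fintype k] (hP : IsClosed ({P} : Set (PlanePoint k)))
    (hlin : NoLinearForm P.asHomogeneousIdeal.toIdeal)
    (hdim : Module.finrank k (formsThrough P 2) = 3) (m : ℕ) :
    globalSections P m = (formsThrough P m).map toAmb := by
  have hP0 : ∃ n, ∃ f ∈ formsThrough P n, f ≠ 0 := by
    refine ⟨2, (Submodule.ne_bot_iff _).1 fun h => ?_⟩
    rw [h, finrank_bot] at hdim
    omega
  ext f
  rw [globalSections, Submodule.mem_iInf, Submodule.mem_map]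
  constructor
  · intro hf
    obtain ⟨F, hF, rfl⟩ := exists_form_of_forall_mem hlin hdim (m := m) (f := f) fun x hx => by
      obtain ⟨z, rfl⟩ := exists_blowupPoint hP0 x
      rw [← lineStalk_eq_twistStalk hP m z hx]
      exact hf z
    obtain ⟨z, hz⟩ := exists_blowupPoint hP0 P
    exact ⟨F, ⟨hF, (form_mem_lineStalk_iff z hz hF).1 (hf z)⟩, rfl⟩
  · rintro ⟨F, ⟨hF, hFP⟩, rfl⟩ z
    by_cases hz : z.base = P
    · exact (form_mem_lineStalk_iff z hz hF).2 hFP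
    · rw [lineStalk_eq_twistStalk hP m z hz]
      exact form_mem_twistStalk _ hF

end BlowupCode

end GlobalSections

/-! ### Rational points of `Z` and the fibres of `ℒ_m` there. -/

noncomputable section RationalPoints

namespace BlowupCode

open MvPolynomial BlowupPoint
open scoped LinearAlgebra.Projectivization

attribute [local instance] MvPolynomial.gradedAlgebra

variable {k : Type*} [Field k]

theorem finrank_residueField_eq_one_iff (B : Subalgebra k (Amb k)) [IsLocalRing B] :
    Module.finrank k (IsLocalRing.ResidueField B) = 1 ↔
      ∀ f : B, ∃ c : k, f - algebraMap k B c ∈ IsLocalRing.maximalIdeal B := by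
  rw [← Subalgebra.bot_eq_top_iff_finrank_eq_one, Algebra.eq_top_iff]
  have key : ∀ (f : B) (c : k), f - algebraMap k B c ∈ IsLocalRing.maximalIdeal B ↔
      algebraMap k (IsLocalRing.ResidueField B) c = IsLocalRing.residue B f := by
    intro f c
    rw [← IsLocalRing.residue_eq_zero_iff, map_sub, sub_eq_zero, Eq.comm]
    rfl
  simp only [key]
  constructor
  · exact fun h f => Algebra.mem_bot.1 (h _)
  · intro h y
    obtain ⟨f, rfl⟩ := IsLocalRing.residue_surjective y
    exact Algebra.mem_bot.2 (h f)

variable {P : PlanePoint k}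

theorem finrank_base_of_isRational {z : BlowupPoint P} (hz : z.IsRational) :
    Module.finrank k (IsLocalRing.ResidueField (localRing z.base)) = 1 := by
  rw [finrank_residueField_eq_one_iff]
  intro f
  obtain ⟨c, hc⟩ := (finrank_residueField_eq_one_iff z.ring).1 hz ⟨f, z.localRing_le_ring f.2⟩
  refine ⟨c, (mem_maximalIdeal_subalgebra_iff _).2 ?_⟩
  rcases (mem_maximalIdeal_subalgebra_iff _).1 hc with h | h
  · exact Or.inl h
  · exact Or.inr fun h' => h (z.localRing_le_ring h')

theorem base_ne_of_finrank (hd : Module.finrank k (IsLocalRing.ResidueField (localRing P)) = 3)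
    {x : PlanePoint k} (hx : Module.finrank k (IsLocalRing.ResidueField (localRing x)) = 1) :
    x ≠ P := by
  rintro rfl
  omega

theorem isRational_of_finrank_base (hP : IsClosed ({P} : Set (PlanePoint k)))
    {z : BlowupPoint P} (hne : z.base ≠ P)
    (h : Module.finrank k (IsLocalRing.ResidueField (localRing z.base)) = 1) : z.IsRational := by
  rw [finrank_residueField_eq_one_iff] at h
  refine (finrank_residueField_eq_one_iff _).2 fun f => ?_
  have hr := z.ring_eq_localRing hP hne
  obtain ⟨c, hc⟩ := h ⟨f, hr.le f.2⟩
  refine ⟨c, (mem_maximalIdeal_subalgebra_iff _).2 ?_⟩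
  rcases (mem_maximalIdeal_subalgebra_iff _).1 hc with h | h
  · exact Or.inl h
  · exact Or.inr fun h' => h (hr.le h')

/-- The rational point of the projective plane with given homogeneous coordinates, as a point of
the scheme. -/
def ofRational (p : ℙ k (Fin 3 → k)) : PlanePoint k := pointOf p.rep p.rep_nonzero

theorem mem_ofRational_iff {p : ℙ k (Fin 3 → k)} {n : ℕ} {f : MvPolynomial (Fin 3) k}
    (hf : f.IsHomogeneous n) : f ∈ (ofRational p).asHomogeneousIdeal ↔ eval p.rep f = 0 := by
  rw [ofRational, mem_pointOf_iff _ hf, aeval_eq_eval]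

theorem finrank_ofRational (p : ℙ k (Fin 3 → k)) :
    Module.finrank k (IsLocalRing.ResidueField (localRing (ofRational p))) = 1 := by
  rw [finrank_residueField_eq (x := ofRational p) p.rep
    (fun n f hf => mem_pointOf_iff _ hf) 0 fun y => ⟨C y, isHomogeneous_C _ _, by simp⟩,
    Module.finrank_self]

/-- Modulo the ideal of `x` each `X j` is a constant `c j` times `X i`, so a form `f` of degree `n`
is congruent to `f(c) * X i ^ n` and vanishes at `x` exactly when `f(c) = 0`. -/
theorem exists_ofRational_eq [Fintype k] {x : PlanePoint k}
    (hx : Module.finrank k (IsLocalRing.ResidueField (localRing x)) = 1) :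
    ∃ p, ofRational p = x := by
  rw [finrank_residueField_eq_one_iff] at hx
  obtain ⟨i, hi⟩ := exists_X_notMem x
  have hX : ∀ j, ∃ c : k, X j - C c * X i ∈ x.asHomogeneousIdeal := by
    intro j
    obtain ⟨c, hc⟩ := hx ⟨_, div_mem_localRing (isHomogeneous_X k j) (isHomogeneous_X k i) hi⟩
    have hom : (X j - C c * X i : MvPolynomial (Fin 3) k).IsHomogeneous 1 :=
      (isHomogeneous_X k j).sub (isHomogeneous_C_mul_X c i)
    refine ⟨c, (div_mem_maximalIdeal_iff hom (isHomogeneous_X k i) hi).1 ?_⟩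
    convert hc using 1
    ext
    have h0 := algebraMap_ne_zero_of_notMem hi
    change _ = algebraMap (MvPolynomial (Fin 3) k) (Amb k) (X j) /
      algebraMap (MvPolynomial (Fin 3) k) (Amb k) (X i) - algebraMap k (Amb k) c
    rw [IsScalarTower.algebraMap_apply k (MvPolynomial (Fin 3) k) (Amb k), algebraMap_eq]
    simp only [map_sub, map_mul]
    field_simp
  choose c hc using hX
  have hmem : ∀ (n : ℕ) (f : MvPolynomial (Fin 3) k), f.IsHomogeneous n →
      (f ∈ x.asHomogeneousIdeal ↔ eval c f = 0) := by
    intro n f hf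
    have h1 := aeval_sub_aeval_mem x.asHomogeneousIdeal.toIdeal X
      ((X i : MvPolynomial (Fin 3) k) • (algebraMap k (MvPolynomial (Fin 3) k) ∘ c))
      (fun j => by
        have := hc j
        rw [mul_comm] at this
        exact this) f
    rw [aeval_smul_of_isHomogeneous hf, aeval_X_left_apply, aeval_algebraMap_apply, aeval_eq_eval,
      algebraMap_eq] at h1
    have h2 : f ∈ x.asHomogeneousIdeal.toIdeal ↔
        X i ^ n * C (eval c f) ∈ x.asHomogeneousIdeal.toIdeal := by
      constructor
      · intro h
        simpa using Ideal.sub_mem _ h h1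
      · intro h
        simpa using Ideal.add_mem _ h1 h
    refine h2.trans ⟨fun h => ?_, fun h => ?_⟩
    · by_contra h0
      refine pow_notMem hi n ?_
      have := Ideal.mul_mem_right (C (eval c f)⁻¹) _ h
      rwa [mul_assoc, ← C_mul, mul_inv_cancel₀ h0, C_1, mul_one] at this
    · rw [h, C_0, mul_zero]
      exact zero_mem _
  have hc0 : c ≠ 0 := by
    rintro rfl
    exact hi ((hmem 1 _ (isHomogeneous_X k i)).2 (by simp))
  refine ⟨Projectivization.mk k c hc0, ext_of_isHomogeneous fun n f hf => ?_⟩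
  rw [mem_ofRational_iff hf, hmem n f hf]
  obtain ⟨a, ha⟩ := Projectivization.exists_smul_eq_mk_rep k c hc0
  rw [← ha]
  exact eval_smul_eq_zero_iff hf a.ne_zero c

theorem blowupPoint_ext_of_base (hP : IsClosed ({P} : Set (PlanePoint k))) {z z' : BlowupPoint P}
    (hne : z.base ≠ P) (h : z.base = z'.base) : z = z' := by
  refine BlowupPoint.ext h ?_
  rw [z.ring_eq_localRing hP hne, z'.ring_eq_localRing hP (h ▸ hne), h]

/-- A rational point of `Z` has a rational image, which differs from the point `P` of degree `3`;
outside `E` the blow-up changes nothing. -/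
theorem exists_equiv_rational [Fintype k] (hP : IsClosedPointOfDegree P 3)
    (hP0 : ∃ n, ∃ f ∈ formsThrough P n, f ≠ 0) :
    ∃ e : ℙ k (Fin 3 → k) ≃ {z : BlowupPoint P // z.IsRational},
      ∀ p, (e p).1.base = ofRational p := by
  obtain ⟨hcl, hd⟩ := hP
  choose z hz using fun p : ℙ k (Fin 3 → k) => exists_blowupPoint hP0 (ofRational p)
  have hne : ∀ p, (z p).base ≠ P := fun p => by
    rw [hz]
    exact base_ne_of_finrank hd (finrank_ofRational p)
  have hrat : ∀ p, (z p).IsRational := fun p =>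
    isRational_of_finrank_base hcl (hne p) (by rw [hz]; exact finrank_ofRational p)
  refine ⟨Equiv.ofBijective (fun p => ⟨z p, hrat p⟩) ⟨fun p p' h => ?_, ?_⟩, hz⟩
  · by_contra hpp
    -- Distinct rational points are told apart by the equation of a line through only one of them.
    obtain ⟨m, hm, hm'⟩ := exists_line_not_mem hpp
    have hzz : ofRational p = ofRational p' := by
      rw [← hz, ← hz, show z p = z p' from congrArg Subtype.val h]
    rw [proj_mem_iff, ← eval_linForm] at hm hm'
    rw [← mem_ofRational_iff (linForm_isHomogeneous _)] at hm hm'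
    exact hm' (hzz ▸ hm)
  · rintro ⟨w, hw⟩
    have hw1 := finrank_base_of_isRational hw
    obtain ⟨p, hp⟩ := exists_ofRational_eq hw1
    exact ⟨p, Subtype.ext (blowupPoint_ext_of_base hcl (hne p) ((hz p).trans hp))⟩

theorem mem_maxIdeal_mul_lineStalk_iff (hP : IsClosed ({P} : Set (PlanePoint k))) {m : ℕ} {z : BlowupPoint P}
    (hne : z.base ≠ P) {i : Fin 3} (hi : (X i : MvPolynomial (Fin 3) k) ∉ z.base.asHomogeneousIdeal)
    {t : Amb k} :
    t ∈ maxIdeal z * lineStalk m z ↔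
      t / algebraMap (MvPolynomial (Fin 3) k) (Amb k) (X i ^ m) ∈ maxIdeal z := by
  rw [lineStalk_eq_twistStalk hP m z hne]
  constructor
  · intro ht
    refine Submodule.mul_induction_on ht (fun u hu r hr => ?_) fun a b ha hb => ?_
    · rw [mul_div_assoc, mul_comm]
      exact z.mul_mem_maxIdeal hu (z.localRing_le_ring (div_X_pow_mem_localRing hi hr))
    · rw [add_div]
      exact add_mem ha hb
  · intro ht
    rw [← div_mul_cancel₀ t (algebraMap_ne_zero_of_notMem (pow_notMem hi m))]
    exact Submodule.mul_mem_mul ht (form_mem_twistStalk _ (isHomogeneous_X_pow i m))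

theorem finrank_fibre (hP : IsClosed ({P} : Set (PlanePoint k))) {m : ℕ} {z : BlowupPoint P}
    (hne : z.base ≠ P) {i : Fin 3} (hi : (X i : MvPolynomial (Fin 3) k) ∉ z.base.asHomogeneousIdeal)
    (hz : z.IsRational) : Module.finrank k (Fibre m z) = 1 := by
  have hX := algebraMap_ne_zero_of_notMem (pow_notMem hi m)
  have hmem : algebraMap (MvPolynomial (Fin 3) k) (Amb k) (X i ^ m) ∈ lineStalk m z := by
    rw [lineStalk_eq_twistStalk hP m z hne]
    exact form_mem_twistStalk _ (isHomogeneous_X_pow i m)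
  refine finrank_eq_one (Submodule.Quotient.mk ⟨_, hmem⟩) ?_ fun w => ?_
  · rw [Ne, Submodule.Quotient.mk_eq_zero, Submodule.submoduleOf, Submodule.mem_comap, Submodule.subtype_apply,
      mem_maxIdeal_mul_lineStalk_iff hP hne hi, div_self hX, z.mem_maxIdeal_iff]
    rintro ⟨h1, h | h⟩
    · exact one_ne_zero h
    · rw [inv_one] at h
      exact h h1
  · obtain ⟨t, rfl⟩ := Submodule.Quotient.mk_surjective _ w
    have ht : (t : Amb k) ∈ twistStalk m z.base :=
      (lineStalk_eq_twistStalk hP m z hne).le t.2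
    obtain ⟨c, hc⟩ := (finrank_residueField_eq_one_iff z.ring).1 hz
      ⟨_, z.localRing_le_ring (div_X_pow_mem_localRing hi ht)⟩
    refine ⟨c, ?_⟩
    rw [Eq.comm, ← Submodule.Quotient.mk_smul, Submodule.Quotient.eq, Submodule.submoduleOf, Submodule.mem_comap, Submodule.subtype_apply,
      mem_maxIdeal_mul_lineStalk_iff hP hne hi]
    refine ⟨_, hc, ?_⟩
    change (t : Amb k) / _ - algebraMap k (Amb k) c = ((t : Amb k) - c • _) / _
    rw [Algebra.smul_def, sub_div, mul_div_cancel_right₀ _ hX]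

theorem nonempty_fibre_equiv (hP : IsClosed ({P} : Set (PlanePoint k))) (m : ℕ)
    {z : BlowupPoint P} (hne : z.base ≠ P) (hz : z.IsRational) :
    Nonempty (Fibre m z ≃ₗ[k] k) := by
  obtain ⟨i, hi⟩ := exists_X_notMem z.base
  have h1 := finrank_fibre hP (m := m) hne hi hz
  have : Module.Finite k (Fibre m z) := Module.finite_of_finrank_pos (by omega)
  exact ⟨LinearEquiv.ofFinrankEq _ _ (by rw [h1, Module.finrank_self])⟩

theorem toAmb_mem_maxIdeal_mul_iff (hP : IsClosed ({P} : Set (PlanePoint k))) {m : ℕ}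
    {z : BlowupPoint P} (hne : z.base ≠ P) {p : ℙ k (Fin 3 → k)} (hp : z.base = ofRational p)
    {F : MvPolynomial (Fin 3) k} (hF : F.IsHomogeneous m) :
    toAmb F ∈ maxIdeal z * lineStalk m z ↔ eval p.rep F = 0 := by
  obtain ⟨i, hi⟩ := exists_X_notMem z.base
  have hloc := div_mem_localRing hF (isHomogeneous_X_pow i m) (pow_notMem hi m)
  rw [mem_maxIdeal_mul_lineStalk_iff hP hne hi, z.mem_maxIdeal_iff, z.ring_eq_localRing hP hne,
    ← mem_ofRational_iff hF, ← hp,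
    ← div_mem_maximalIdeal_iff hF (isHomogeneous_X_pow i m) (pow_notMem hi m),
    mem_maximalIdeal_subalgebra_iff]
  exact and_iff_right hloc

end BlowupCode

end RationalPoints

/-! ### Dimension and minimum distance of the code. -/

noncomputable section CodeParameters

namespace BlowupCode

open MvPolynomial BlowupPoint
open scoped LinearAlgebra.Projectivization

attribute [local instance] MvPolynomial.gradedAlgebra

theorem toAmb_injective {k : Type*} [Field k] : Function.Injective (toAmb (k := k)) :=
  algebraMap_amb_injective

variable {k : Type*} [Field k] [Fintype k] {P : PlanePoint k}

/-- Passing through two points is two linear conditions on a space of dimension `3`. -/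
theorem exists_conic (hdim : Module.finrank k (formsThrough P 2) = 3) (p p' : ℙ k (Fin 3 → k)) :
    ∃ g ∈ formsThrough P 2, g ≠ 0 ∧ p ∈ zeros g ∧ p' ∈ zeros g := by
  let L : formsThrough P 2 →ₗ[k] k × k :=
    ((aeval p.rep : MvPolynomial (Fin 3) k →ₐ[k] k).toLinearMap.prod
      (aeval p'.rep : MvPolynomial (Fin 3) k →ₐ[k] k).toLinearMap) ∘ₗ (formsThrough P 2).subtype
  have : Module.Finite k (formsThrough P 2) := Module.finite_of_finrank_pos (by omega)
  have hker : LinearMap.ker L ≠ ⊥ := LinearMap.ker_ne_bot_of_finrank_lt (by simp [hdim])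
  obtain ⟨g, hg, hg0⟩ := (Submodule.ne_bot_iff _).1 hker
  have h1 : aeval p.rep (g : MvPolynomial (Fin 3) k) = 0 :=
    congrArg Prod.fst (LinearMap.mem_ker.1 hg)
  have h2 : aeval p'.rep (g : MvPolynomial (Fin 3) k) = 0 :=
    congrArg Prod.snd (LinearMap.mem_ker.1 hg)
  rw [aeval_eq_eval] at h1 h2
  exact ⟨g, g.2, fun h0 => hg0 (Subtype.ext h0), mem_zeros.2 h1, mem_zeros.2 h2⟩

theorem evalMap_eq_zero_iff (hP : IsClosed ({P} : Set (PlanePoint k))) {m n : ℕ} (φ : Frame P m n)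
    (s : globalSections P m) {F : MvPolynomial (Fin 3) k} (hF : F.IsHomogeneous m)
    (hs : (s : Amb k) = toAmb F) (i : Fin n) {p : ℙ k (Fin 3 → k)}
    (hne : (φ.pts i).1.base ≠ P) (hp : (φ.pts i).1.base = ofRational p) :
    evalMap φ s i = 0 ↔ p ∈ zeros F := by
  rw [mem_zeros, ← toAmb_mem_maxIdeal_mul_iff hP hne hp hF, ← hs]
  change φ.coord i (Submodule.Quotient.mk _) = 0 ↔ _
  rw [LinearEquiv.map_eq_zero_iff, Submodule.Quotient.mk_eq_zero]
  rfl

theorem hammingNorm_evalMap [DecidableEq k] (hP : IsClosedPointOfDegree P 3)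
    (hP0 : ∃ n, ∃ f ∈ formsThrough P n, f ≠ 0) {m n : ℕ} (φ : Frame P m n)
    (s : globalSections P m) {F : MvPolynomial (Fin 3) k} (hF : F.IsHomogeneous m)
    (hs : (s : Amb k) = toAmb F) : hammingNorm (evalMap φ s) + (zeros F).card = n := by
  classical
  obtain ⟨e, he⟩ := exists_equiv_rational hP hP0
  let ψ : Fin n ≃ ℙ k (Fin 3 → k) := φ.pts.trans e.symm
  have hbase : ∀ i, (φ.pts i).1.base = ofRational (ψ i) := fun i => by
    rw [← he]
    simp [ψ]
  have h0 : ∀ i, evalMap φ s i = 0 ↔ ψ i ∈ zeros F := fun i =>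
    evalMap_eq_zero_iff hP.1 φ s hF hs i
      (by rw [hbase]; exact base_ne_of_finrank hP.2 (finrank_ofRational _)) (hbase i)
  have hz : (Finset.univ.filter fun i => evalMap φ s i = 0).card = (zeros F).card := by
    refine Finset.card_bij (fun i _ => ψ i) (fun i hi => (h0 i).1 (Finset.mem_filter.1 hi).2)
      (fun i _ j _ h => ψ.injective h) fun p hp => ⟨ψ.symm p, ?_, ψ.apply_symm_apply p⟩
    rw [Finset.mem_filter, h0, ψ.apply_symm_apply]
    exact ⟨Finset.mem_univ _, hp⟩
  rw [← hz, hammingNorm, add_comm, Finset.card_filter_add_card_filter_not, Finset.card_univ,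
    Fintype.card_fin]

theorem blowupCode_parameters [DecidableEq k] (hq : 5 ≤ Fintype.card k)
    (hP : IsClosedPointOfDegree P 3) (hl : ¬ LiesOnRationalLine P) :
    BlowupCodeHasParameters P 5 (Fintype.card k ^ 2 + Fintype.card k + 1) 18
      (Fintype.card k ^ 2 - 3 * Fintype.card k - 1) := by
  have hlin := noLinearForm_of_not_liesOnRationalLine hl
  have hdim2 : Module.finrank k (formsThrough P 2) = 3 := by
    have : Module.finrank k (formsThrough P 2) + 3 = 6 := finrank_formsThrough hP.2 hlin 1
    omega
  have hdim5 : Module.finrank k (formsThrough P 5) = 18 := by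
    have : Module.finrank k (formsThrough P 5) + 3 = 21 := finrank_formsThrough hP.2 hlin 4
    omega
  have hP0 : ∃ n, ∃ f ∈ formsThrough P n, f ≠ 0 := by
    refine ⟨2, (Submodule.ne_bot_iff _).1 fun h => ?_⟩
    rw [h, finrank_bot] at hdim2
    omega
  have hsec := globalSections_eq hP.1 hlin hdim2 5
  -- This makes the subtractions in the minimum distance genuine and the distance positive, which is
  -- what yields injectivity of the evaluation below.
  have hsq : 5 * Fintype.card k ≤ Fintype.card k ^ 2 := by nlinarith
  constructor
  · obtain ⟨e, he⟩ := exists_equiv_rational hP hP0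
    have e' := (Fintype.equivFinOfCardEq (card_projectivePlane (k := k))).symm.trans e
    refine ⟨⟨e', fun i => (nonempty_fibre_equiv hP.1 5 ?_ (e' i).2).some⟩⟩
    exact base_ne_of_finrank hP.2 (finrank_base_of_isRational (e' i).2)
  intro φ
  have hform : ∀ s : globalSections P 5, ∃ F ∈ formsThrough P 5, (s : Amb k) = toAmb F := by
    intro s
    obtain ⟨F, hF, hs⟩ := hsec.le s.2
    exact ⟨F, hF, hs.symm⟩
  have hnorm : ∀ s : globalSections P 5, s ≠ 0 →
      Fintype.card k ^ 2 - 3 * Fintype.card k - 1 ≤ hammingNorm (evalMap φ s) := by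
    intro s hs0
    obtain ⟨F, ⟨hF, hFP⟩, hs⟩ := hform s
    have hF0 : F ≠ 0 := by
      rintro rfl
      exact hs0 (Subtype.ext (hs.trans (map_zero _)))
    have h1 := hammingNorm_evalMap hP hP0 φ s hF hs
    have h2 := card_zeros_quintic_le P.isPrime hlin hq hF hFP hF0
    omega
  have hinj : Function.Injective (evalMap φ) := by
    rw [injective_iff_map_eq_zero]
    intro s hs
    by_contra hs0
    have := hnorm s hs0
    rw [hs, hammingNorm_zero] at this
    omega
  refine ⟨?_, ⟨?_, ?_⟩⟩
  · rw [code, LinearMap.finrank_range_of_inj hinj, hsec,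
      ← (Submodule.equivMapOfInjective toAmb toAmb_injective (formsThrough P 5)).finrank_eq, hdim5]
  · obtain ⟨p, p', hne⟩ : ∃ p p' : ℙ k (Fin 3 → k), p ≠ p' := by
      refine Fintype.exists_pair_of_one_lt_card ?_
      rw [card_projectivePlane]
      omega
    -- Two rational points on the conic are enough to force `q + 1` of them.
    obtain ⟨g, hg, hg0, hp, hp'⟩ := exists_conic hdim2 p p'
    obtain ⟨F, hFP, hF, hcard⟩ := exists_quintic_card_zeros P.isPrime hlin hq hg.1 hg.2 hg0 hp hp' hne
    let s : globalSections P 5 := ⟨toAmb F, hsec.ge ⟨F, ⟨hF, hFP⟩, rfl⟩⟩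
    have h1 := hammingNorm_evalMap hP hP0 φ s hF rfl
    refine ⟨evalMap φ s, ⟨s, rfl⟩, 0, zero_mem _, fun h => ?_, ?_⟩
    · rw [h, hammingNorm_zero] at h1
      omega
    · rw [hammingDist_zero_right]
      omega
  · rintro _ ⟨_, ⟨s, rfl⟩, _, ⟨s', rfl⟩, hne, rfl⟩
    rw [hammingDist_eq_hammingNorm, ← map_neg, ← map_add]
    exact hnorm _ fun h => hne (by rw [neg_add_eq_zero.1 h])

end BlowupCode

end CodeParameters

theorem mainTheorem11 {k : Type*} [Field k] [Fintype k] [DecidableEq k] (q : ℕ)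
    (hq : Fintype.card k = q) (hq5 : 5 ≤ q) :
    (∃ P : BlowupCode.PlanePoint k, BlowupCode.IsClosedPointOfDegree P 3 ∧
      ¬ BlowupCode.LiesOnRationalLine P) ∧
    (∀ P : BlowupCode.PlanePoint k, BlowupCode.IsClosedPointOfDegree P 3 →
      ¬ BlowupCode.LiesOnRationalLine P →
      BlowupCode.BlowupCodeHasParameters P 5 (q ^ 2 + q + 1) 18 (q ^ 2 - 3 * q - 1)) ∧
    (q = 9 → ∀ P : BlowupCode.PlanePoint k, BlowupCode.IsClosedPointOfDegree P 3 →
      ¬ BlowupCode.LiesOnRationalLine P →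
      BlowupCode.BlowupCodeHasParameters P 5 91 18 53) := by
  subst hq
  refine ⟨BlowupCode.exists_point_of_degree_three,
    fun P hP hl => BlowupCode.blowupCode_parameters hq5 hP hl, fun h9 P hP hl => ?_⟩
  have := BlowupCode.blowupCode_parameters hq5 hP hl
  rwa [h9] at this
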